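/- Let $K$ be an infinite field, $S=K[x_1,\ldots,x_n]$ with the standard grading, and $\mathfrak m=(x_1,\ldots,x_n)$. Let $I\subset S$ be a complete intersection monomial ideal (i.e. a monomial ideal generated by an $S$-regular sequence; in particular $I\neq S$), minimally generated by $m$ monomials. Then $m\le n$ and $$\operatorname{hdepth}(S/I)=\dim(S/I)=\operatorname{sdepth}(S/I)=\operatorname{depth}(S/I)=n-m .$$ Here $\dim$ is the Krull dimension, and: - for a finitely generated nonzero graded $S$-module $M$, $\operatorname{depth}(M)$ is the maximal length of an $M$-regular sequence contained in $\mathfrak m$; - $\operatorname{hdepth}(M)$ is the maximum of $\operatorname{depth}(N)$ over all finitely generated graded $S$-modules $N$ with the same Hilbert series $\sum_j(\dim_K N_j)t^j=\sum_j(\dim_K M_j)t^j$; - a Stanley decomposition $\mathcal D$ of $S/I$ is a decomposition $S/I=\bigoplus_{i=1}^r m_iK[Z_i]$ as a direct sum of $K$-vector spaces, where $m_i\in S$ is a monomial, $Z_i\subset\{x_1,\ldots,x_n\}$, and $m_iK[Z_i]$ is the image of the map $K[Z_i]\to S/I$, $f\mapsto m_if+I$, which is required to be injective; $\operatorname{sdepth}(\mathcal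 D)=\min_i|Z_i|$, and $\operatorname{sdepth}(S/I)$ is the maximum of $\operatorname{sdepth}(\mathcal D)$ over all Stanley decompositions $\mathcal D$ of $S/I$. -/

import Mathlib

universe u

namespace HilbertDepth

open MvPolynomial

noncomputable section

/-- The monomials `x^(u 0), …, x^(u (m-1))` generate the ideal `I`, and none of them lies in the
ideal generated by the others: `I` is minimally generated by these `m` monomials. -/
def IsMinimallyGeneratedBy {K : Type u} [Field K] {n m : ℕ}
    (I : Ideal (MvPolynomial (Fin n) K)) (u : Fin m → (Fin n →₀ ℕ)) : Prop :=
  I = Ideal.span (Set.range fun i => monomial (u i) (1 : K)) ∧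
    ∀ i, monomial (u i) (1 : K) ∉
      Ideal.span ((fun j => monomial (u j) (1 : K)) '' {j | j ≠ i})

/-- A complete intersection ideal of a commutative ring: an ideal that is generated by a regular
sequence (in particular it is a proper ideal). -/
def IsCompleteIntersection {R : Type u} [CommRing R] (I : Ideal R) : Prop :=
  ∃ fs : List R, RingTheory.Sequence.IsRegular R fs ∧ Ideal.ofList fs = I

/-- `depth M = d`, for a module `M` over `S = K[x_1, …, x_n]`: the maximal length of an
`M`-regular sequence in the ideal `(x_1, …, x_n)` is `d`. -/
def IsDepth (K : Type u) [Field K] (n : ℕ) (M : Type u) [AddCommGroup M]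
    [Module (MvPolynomial (Fin n) K) M] (d : ℕ) : Prop :=
  IsGreatest {k : ℕ | ∃ fs : List (MvPolynomial (Fin n) K), fs.length = k ∧
    (∀ f ∈ fs, f ∈ idealOfVars (Fin n) K) ∧ RingTheory.Sequence.IsRegular M fs} d

/-- The subspaces `ℳ j` make `M` a graded module over `S = K[x_1, …, x_n]` with its standard
grading: `M = ⨁ ℳ j` and `S_i • ℳ j ⊆ ℳ (i + j)`. -/
def IsGradedModule {K : Type u} [Field K] {n : ℕ} {M : Type u} [AddCommGroup M] [Module K M]
    [Module (MvPolynomial (Fin n) K) M] (ℳ : ℕ → Submodule K M) : Prop :=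
  DirectSum.IsInternal ℳ ∧
    ∀ (i j : ℕ), ∀ f ∈ homogeneousSubmodule (Fin n) K i, ∀ x ∈ ℳ j, f • x ∈ ℳ (i + j)

/-- The Hilbert series `∑ (dim_K M_j) t^j`. -/
def hilbertSeries {K : Type u} [Field K] {M : Type u} [AddCommGroup M] [Module K M]
    (ℳ : ℕ → Submodule K M) : PowerSeries ℤ :=
  PowerSeries.mk fun j => (Module.finrank K (ℳ j) : ℤ)

/-- `hdepth M = d`, for a module `M` graded by `ℳ`: the maximum of `depth N`, over the finitely
generated graded `S`-modules `N` with the same Hilbert series as `M`, is `d`.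
(Since `M` lives in degrees `≥ 0`, so does every graded module with the Hilbert series of `M`.) -/
def IsHilbertDepth {K : Type u} [Field K] (n : ℕ) {M : Type u} [AddCommGroup M] [Module K M]
    (ℳ : ℕ → Submodule K M) (d : ℕ) : Prop :=
  IsGreatest {r : ℕ | ∃ (N : Type u) (_ : AddCommGroup N) (_ : Module K N)
    (_ : Module (MvPolynomial (Fin n) K) N) (_ : IsScalarTower K (MvPolynomial (Fin n) K) N)
    (𝒩 : ℕ → Submodule K N),
      Module.Finite (MvPolynomial (Fin n) K) N ∧ IsGradedModule (n := n) 𝒩 ∧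
        hilbertSeries 𝒩 = hilbertSeries ℳ ∧ IsDepth K n N r} d

/-- The standard grading of `S ⧸ I`: the component of degree `j` is the image of the space of
homogeneous polynomials of degree `j`. -/
def quotientGrading {K : Type u} [Field K] {n : ℕ} (I : Ideal (MvPolynomial (Fin n) K)) (j : ℕ) :
    Submodule K (MvPolynomial (Fin n) K ⧸ I) :=
  (homogeneousSubmodule (Fin n) K j).map (Ideal.Quotient.mkₐ K I).toLinearMap

/-- The `K`-linear map `S → S ⧸ I`, `f ↦ x^a f + I`. -/
def mulMonomial {K : Type u} [Field K] {n : ℕ} (I : Ideal (MvPolynomial (Fin n) K))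
    (a : Fin n →₀ ℕ) : MvPolynomial (Fin n) K →ₗ[K] MvPolynomial (Fin n) K ⧸ I :=
  (Ideal.Quotient.mkₐ K I).toLinearMap ∘ₗ LinearMap.mulLeft K (monomial a (1 : K))

/-- `S ⧸ I = ⨁ x^(a i) K[Z i]` is a Stanley decomposition: each `x^(a i) K[Z i]` is a free
`K[Z i]`-module of rank one (multiplication by `x^(a i)` is injective from `K[Z i]` to `S ⧸ I`),
and `S ⧸ I` is the direct sum of these `K`-subspaces. -/
def IsStanleyDecomposition {K : Type u} [Field K] {n r : ℕ} (I : Ideal (MvPolynomial (Fin n) K))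
    (a : Fin r → (Fin n →₀ ℕ)) (Z : Fin r → Finset (Fin n)) : Prop :=
  (∀ i, Set.InjOn (mulMonomial I (a i)) (supported K (Z i : Set (Fin n)))) ∧
    DirectSum.IsInternal fun i =>
      (Subalgebra.toSubmodule (supported K (Z i : Set (Fin n)))).map (mulMonomial I (a i))

/-- `sdepth (S ⧸ I) = d`: the maximum of `min |Z i|`, over the Stanley decompositions of `S ⧸ I`,
is `d`. -/
def IsStanleyDepth {K : Type u} [Field K] {n : ℕ} (I : Ideal (MvPolynomial (Fin n) K)) (d : ℕ) :
    Prop :=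
  IsGreatest {s : ℕ | ∃ (r : ℕ) (a : Fin r → (Fin n →₀ ℕ)) (Z : Fin r → Finset (Fin n)),
    IsStanleyDecomposition I a Z ∧ IsLeast (Set.range fun i => (Z i).card) s} d

end

end HilbertDepth

/-! Nearly everything follows from one consequence of the hypothesis: the minimal monomial
generators are pairwise coprime. Relations among the members of a regular sequence have their
coefficients in the ideal, and a change of generators carries this property to the monomials
(`card_eq_and_mem_of_sum_mul_eq_zero`). The relation between two generators, divided by their gcd,
then excludes a common variable.

Choosing one variable from each generator is therefore injective, so m ≤ n and n - m variables
remain. A monomial outside I is too small in some variable of every generator. Sorting by the first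
such variables and the exponents there gives Stanley spaces with n - m free variables, and no
Stanley space can have more. Identifying the variables of each generator with the chosen one, and
killing the variables of no generator, gives n - m linear forms regular on S/I. Killing the chosen
variables bounds the dimension below; the m-term regular sequence generating I bounds it above.

The upper bounds for depth and Hilbert depth see only the Hilbert function. A regular sequence of
length r on N yields a copy of a polynomial ring in r variables inside N
(`exists_forall_aeval_smul_eq_zero`), so the summed dimensions grow at least like J^r. In S/I every
standard monomial has a bounded exponent in one variable of each generator, so they grow at most
like J^(n-m). The module S/I itself attains the bound. -/

namespace RegularSequence

/-! ### Relations on a regular sequence and change of generators. -/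

open RingTheory.Sequence Matrix

/-- The coefficients of a relation among the members of a regular sequence lie in the ideal that
the sequence generates. -/
theorem mem_of_sum_mul_eq_zero {R : Type*} [CommRing R] (f : ℕ → R) (r : ℕ)
    (h : ∀ k < r, ∀ x, f k * x ∈ Ideal.span (f '' Set.Iio k) → x ∈ Ideal.span (f '' Set.Iio k))
    (c : ℕ → R) (hc : ∑ i ∈ Finset.range r, c i * f i = 0) :
    ∀ i < r, c i ∈ Ideal.span (f '' Set.Iio r) := by
  induction r generalizing c with
  | zero => intro i hi; omega
  | succ r ih =>
    have hle : Ideal.span (f '' Set.Iio r) ≤ Ideal.span (f '' Set.Iio (r + 1)) :=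
      Ideal.span_mono (Set.image_mono (Set.Iio_subset_Iio (Nat.le_succ r)))
    have hfr : f r ∈ Ideal.span (f '' Set.Iio (r + 1)) :=
      Ideal.subset_span ⟨r, Nat.lt_succ_self r, rfl⟩
    rw [Finset.sum_range_succ] at hc
    have hlast : c r ∈ Ideal.span (f '' Set.Iio r) := by
      apply h r (Nat.lt_succ_self r)
      rw [mul_comm, eq_neg_of_add_eq_zero_right hc]
      refine neg_mem (sum_mem fun i hi => Ideal.mul_mem_left _ _ (Ideal.subset_span ?_))
      exact ⟨i, Finset.mem_range.1 hi, rfl⟩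
    obtain ⟨d, hd⟩ : ∃ d : ℕ → R, c r = ∑ i ∈ Finset.range r, d i * f i := by
      have h1 : f '' Set.Iio r = Set.range fun i : Fin r => f i := by
        ext x
        constructor
        · rintro ⟨i, hi, rfl⟩
          exact ⟨⟨i, hi⟩, rfl⟩
        · rintro ⟨i, rfl⟩
          exact ⟨i, i.2, rfl⟩
      rw [h1, Ideal.mem_span_range_iff_exists_fun] at hlast
      obtain ⟨d, hd⟩ := hlast
      refine ⟨fun i => if hi : i < r then d ⟨i, hi⟩ else 0, ?_⟩
      rw [Finset.sum_range, ← hd]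
      simp
    -- Substituting the expression for `c r` leaves a relation among the first r members, with
    -- coefficients `c i + d i * f r`.
    have key := ih (fun k hk => h k (hk.trans (Nat.lt_succ_self r)))
      (fun i => c i + d i * f r) (by
        rw [← hc, hd, Finset.sum_mul, ← Finset.sum_add_distrib]
        exact Finset.sum_congr rfl fun i _ => by ring)
    intro i hi
    rcases Nat.lt_succ_iff_lt_or_eq.1 hi with hi | rfl
    · have := sub_mem (hle (key i hi)) (Ideal.mul_mem_left _ (d i) hfr)
      simpa using this
    · exact hle hlast

theorem ofList_eq_span_range {R : Type*} [CommRing R] (fs : List R) :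
    Ideal.ofList fs = Ideal.span (Set.range fun i : Fin fs.length => fs[i]) := by
  unfold Ideal.ofList
  congr 1
  ext x
  simp [List.mem_iff_get]

theorem mem_ofList_of_sum_mul_eq_zero {R : Type*} [CommRing R] {fs : List R}
    (h : IsWeaklyRegular R fs) (c : Fin fs.length → R) (hc : ∑ i, c i * fs[i] = 0)
    (i : Fin fs.length) : c i ∈ Ideal.ofList fs := by
  have hspan : ∀ k ≤ fs.length,
      Ideal.ofList (fs.take k) = Ideal.span ((fun i => fs.getD i 0) '' Set.Iio k) := by
    intro k hk
    unfold Ideal.ofList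
    congr 1
    ext x
    simp only [Set.mem_ofPred_eq, List.mem_take_iff_getElem, Set.mem_image, Set.mem_Iio]
    constructor
    · rintro ⟨j, hj, rfl⟩
      exact ⟨j, by omega, List.getD_eq_getElem _ _ _⟩
    · rintro ⟨j, hj, rfl⟩
      exact ⟨j, by omega, (List.getD_eq_getElem _ _ _).symm⟩
  have := mem_of_sum_mul_eq_zero (fun i => fs.getD i 0) fs.length (fun k hk x hx => by
      have hreg := h.regular_mod_prev k hk
      rw [isSMulRegular_quotient_iff_mem_of_smul_mem] at hreg
      have := hreg x
      simp only [smul_eq_mul, Ideal.mul_top, hspan k hk.le] at this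
      refine this ?_
      rwa [← List.getD_eq_getElem fs 0 hk])
    (fun i => if hi : i < fs.length then c ⟨i, hi⟩ else 0)
    (by rw [Finset.sum_range, ← hc]; simp) i i.2
  rw [← hspan _ le_rfl, List.take_length] at this
  simpa using this

/-- If an ideal is generated by a family whose relations have their coefficients in the ideal, then
the same holds for every irredundant generating family, and the two families have the same
cardinality. -/
theorem card_eq_and_mem_of_sum_mul_eq_zero {R : Type*} [CommRing R] {I J : Ideal R} (hI : I ≠ ⊤)
    (hJ : J ≠ ⊤) {r m : ℕ} (f : Fin r → R) (g : Fin m → R) (hf : Ideal.span (Set.range f) = I)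
    (hg : Ideal.span (Set.range g) = I)
    (hfI : ∀ c : Fin r → R, ∑ i, c i * f i = 0 → ∀ i, c i ∈ I)
    (hgJ : ∀ c : Fin m → R, ∑ i, c i * g i = 0 → ∀ i, c i ∈ J) :
    r = m ∧ ∀ c : Fin m → R, ∑ i, c i * g i = 0 → ∀ i, c i ∈ I := by
  have hA : ∀ i, ∃ c : Fin r → R, ∑ j, c j * f j = g i := fun i =>
    Ideal.mem_span_range_iff_exists_fun.1 (by rw [hf, ← hg]; exact Ideal.subset_span ⟨i, rfl⟩)
  have hB : ∀ i, ∃ c : Fin m → R, ∑ j, c j * g j = f i := fun i =>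
    Ideal.mem_span_range_iff_exists_fun.1 (by rw [hg, ← hf]; exact Ideal.subset_span ⟨i, rfl⟩)
  choose A hA using hA
  choose B hB using hB
  have hAf : Matrix.of A *ᵥ f = g := funext hA
  have hBg : Matrix.of B *ᵥ g = f := funext hB
  -- If M fixes the generating vector, the rows of M - 1 are relations. Applied to BA and AB this
  -- gives inverses modulo I and modulo J, hence the two inequalities between r and m.
  have quot_eq_one : ∀ {k : ℕ} (L : Ideal R) (M : Matrix (Fin k) (Fin k) R) (w : Fin k → R),
      (∀ c : Fin k → R, ∑ i, c i * w i = 0 → ∀ i, c i ∈ L) → M *ᵥ w = w →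
      M.map (Ideal.Quotient.mk L) = 1 := by
    intro k L M w hw hM
    have h1 : ∀ i j, (M - 1) i j ∈ L := fun i => hw _ (by
      have := congrFun (show (M - 1) *ᵥ w = 0 by rw [Matrix.sub_mulVec, hM]; simp) i
      simpa [Matrix.mulVec, dotProduct] using this)
    ext i j
    have := Ideal.Quotient.eq_zero_iff_mem.2 (h1 i j)
    rw [Matrix.sub_apply, map_sub, sub_eq_zero] at this
    rw [Matrix.map_apply, this, Matrix.one_apply, Matrix.one_apply]
    split_ifs <;> simp
  have hBA := quot_eq_one I (Matrix.of B * Matrix.of A) f hfI (by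
    rw [← Matrix.mulVec_mulVec, hAf, hBg])
  have hAB := quot_eq_one J (Matrix.of A * Matrix.of B) g hgJ (by
    rw [← Matrix.mulVec_mulVec, hBg, hAf])
  have : Nontrivial (R ⧸ I) := Ideal.Quotient.nontrivial_iff.2 hI
  have : Nontrivial (R ⧸ J) := Ideal.Quotient.nontrivial_iff.2 hJ
  rw [Matrix.map_mul] at hBA hAB
  have card_le : ∀ {L : Ideal R} [Nontrivial (R ⧸ L)] {k l : ℕ} (M : Matrix (Fin k) (Fin l) (R ⧸ L))
      (N : Matrix (Fin l) (Fin k) (R ⧸ L)), M * N = 1 → k ≤ l := by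
    intro L _ k l M N hMN
    refine le_of_fin_surjective (R ⧸ L) M.mulVecLin fun y => ⟨N *ᵥ y, ?_⟩
    rw [Matrix.mulVecLin_apply, Matrix.mulVec_mulVec, hMN, Matrix.one_mulVec]
  obtain rfl : r = m := le_antisymm (card_le _ _ hBA) (card_le _ _ hAB)
  refine ⟨rfl, fun c hc i => ?_⟩
  have h1 : ∀ j, (c ᵥ* Matrix.of A) j ∈ I := hfI _ (by
    change (c ᵥ* Matrix.of A) ⬝ᵥ f = 0
    rw [← Matrix.dotProduct_mulVec, hAf]
    exact hc)
  have h2 : (Ideal.Quotient.mk I ∘ c) ᵥ* (Matrix.of A).map (Ideal.Quotient.mk I) = 0 := by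
    ext j
    have := Ideal.Quotient.eq_zero_iff_mem.2 (h1 j)
    rw [RingHom.map_vecMul] at this
    exact this
  have h3 := congrFun (congrArg (· ᵥ* (Matrix.of B).map (Ideal.Quotient.mk I)) h2) i
  -- The matrices are now square, so BA = 1 modulo I gives AB = 1 modulo I, and c = cAB vanishes
  -- there.
  rw [Matrix.vecMul_vecMul, mul_eq_one_comm.1 hBA] at h3
  exact Ideal.Quotient.eq_zero_iff_mem.1 (by simpa using h3)

end RegularSequence

namespace HilbertDepth

open MvPolynomial RingTheory.Sequence

/-! ### Coprimality of the minimal monomial generators. -/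

section Monomial

variable {K : Type u} [Field K] {n m : ℕ} {I : Ideal (MvPolynomial (Fin n) K)}
  {v : Fin m → (Fin n →₀ ℕ)}

theorem IsMinimallyGeneratedBy.mem_iff (h : IsMinimallyGeneratedBy I v)
    {f : MvPolynomial (Fin n) K} : f ∈ I ↔ ∀ a ∈ f.support, ∃ i, v i ≤ a := by
  rw [h.1, show (Set.range fun i => monomial (v i) (1 : K)) =
    (fun s => monomial s (1 : K)) '' Set.range v from Set.range_comp (fun s => monomial s (1 : K)) v,
    mem_ideal_span_monomial_image]
  simp

theorem IsMinimallyGeneratedBy.monomial_mem_iff (h : IsMinimallyGeneratedBy I v)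
    {a : Fin n →₀ ℕ} : monomial a (1 : K) ∈ I ↔ ∃ i, v i ≤ a := by
  classical
  rw [h.mem_iff, support_monomial, if_neg one_ne_zero]
  simp

theorem IsMinimallyGeneratedBy.eq_of_le (h : IsMinimallyGeneratedBy I v) {i j : Fin m}
    (hij : v i ≤ v j) : i = j := by
  by_contra hne
  refine h.2 j (Ideal.mem_of_dvd _ (monomial_dvd_monomial.2 ⟨Or.inr hij, dvd_rfl⟩)
    (Ideal.subset_span ⟨i, hne, rfl⟩))

theorem IsMinimallyGeneratedBy.ne_zero (h : IsMinimallyGeneratedBy I v) (hI : I ≠ ⊤)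
    (i : Fin m) : v i ≠ 0 := fun h0 =>
  hI ((Ideal.eq_top_iff_one _).2 (h.monomial_mem_iff.2 ⟨i, h0.le⟩))

/-- The coefficients of a relation among the minimal monomial generators have no constant term. -/
theorem IsMinimallyGeneratedBy.constantCoeff_eq_zero (h : IsMinimallyGeneratedBy I v)
    (c : Fin m → MvPolynomial (Fin n) K) (hc : ∑ i, c i * monomial (v i) (1 : K) = 0)
    (i : Fin m) : constantCoeff (c i) = 0 := by
  classical
  have := congrArg (coeff (v i)) hc
  rw [coeff_sum, Finset.sum_eq_single i] at this
  · simpa [coeff_mul_monomial', constantCoeff_eq] using this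
  · intro j _ hji
    rw [coeff_mul_monomial', if_neg fun hle => hji (h.eq_of_le hle)]
  · simp

/-- The auxiliary ideal J of the change of generators is the kernel of the constant coefficient:
minimality forces relations among the monomials to have coefficients there. -/
theorem IsCompleteIntersection.exists_isRegular (h : IsMinimallyGeneratedBy I v)
    (hci : IsCompleteIntersection I) :
    (∃ fs : List (MvPolynomial (Fin n) K),
      IsWeaklyRegular (MvPolynomial (Fin n) K) fs ∧ Ideal.ofList fs = I ∧ fs.length = m) ∧
    ∀ c : Fin m → MvPolynomial (Fin n) K, ∑ i, c i * monomial (v i) (1 : K) = 0 → ∀ i, c i ∈ I := by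
  obtain ⟨fs, hfs, rfl⟩ := hci
  have hne : Ideal.ofList fs ≠ ⊤ := fun htop => hfs.top_ne_smul (by simp [htop])
  have := RegularSequence.card_eq_and_mem_of_sum_mul_eq_zero hne
    (J := RingHom.ker (constantCoeff (R := K) (σ := Fin n))) (RingHom.ker_ne_top _)
    (fun i : Fin fs.length => fs[i]) (fun i => monomial (v i) (1 : K))
    (RegularSequence.ofList_eq_span_range fs).symm h.1.symm
    (RegularSequence.mem_ofList_of_sum_mul_eq_zero hfs.toIsWeaklyRegular)
    h.constantCoeff_eq_zero
  exact ⟨⟨fs, hfs.toIsWeaklyRegular, rfl, this.1⟩, this.2⟩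

theorem IsCompleteIntersection.ne_top (hci : IsCompleteIntersection I) : I ≠ ⊤ := by
  obtain ⟨fs, hfs, rfl⟩ := hci
  exact fun htop => hfs.top_ne_smul (by simp [htop])

/-- The minimal monomial generators of a complete intersection are pairwise coprime. -/
theorem IsCompleteIntersection.eq_of_mem_support (h : IsMinimallyGeneratedBy I v)
    (hci : IsCompleteIntersection I) {i j : Fin m} {k : Fin n} (hi : v i k ≠ 0)
    (hj : v j k ≠ 0) : i = j := by
  classical
  by_contra hne
  -- The relation between the two generators divided by their gcd; its coefficient x^(v j)/gcd must
  -- lie in I.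
  have hrel := (IsCompleteIntersection.exists_isRegular h hci).2
    (Pi.single i (monomial (v j - v i ⊓ v j) 1) - Pi.single j (monomial (v i - v i ⊓ v j) 1)) (by
      have h1 : v j - v i ⊓ v j + v i = v i - v i ⊓ v j + v j := by
        ext l
        simp only [Finsupp.add_apply, Finsupp.tsub_apply, Finsupp.inf_apply]
        omega
      simp only [Pi.sub_apply, sub_mul, Finset.sum_sub_distrib, Pi.single_apply, ite_mul, zero_mul,
        Finset.sum_ite_eq', Finset.mem_univ, if_true, monomial_mul, mul_one, h1, sub_self]) i
  rw [Pi.sub_apply, Pi.single_eq_same, Pi.single_eq_of_ne hne, sub_zero,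
    h.monomial_mem_iff] at hrel
  obtain ⟨l, hl⟩ := hrel
  -- A generator dividing x^(v j)/gcd divides x^(v j), so it is x^(v j) itself, although the gcd
  -- involves x_k.
  obtain rfl := h.eq_of_le (hl.trans tsub_le_self)
  have := hl k
  simp only [Finsupp.tsub_apply, Finsupp.inf_apply] at this
  omega

end Monomial

end HilbertDepth

namespace HilbertDepth

open MvPolynomial RingTheory.Sequence

/-! ### Decomposing S/I along partitions of the standard monomials. -/

section Decomposition

variable {K : Type u} [Field K] {n m : ℕ} {I : Ideal (MvPolynomial (Fin n) K)}
  {v : Fin m → (Fin n →₀ ℕ)}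

/-- The `K`-subspace of `S ⧸ I` spanned by the monomials with exponents in `P`. -/
noncomputable def monomialSpan (I : Ideal (MvPolynomial (Fin n) K)) (P : Set (Fin n →₀ ℕ)) :
    Submodule K (MvPolynomial (Fin n) K ⧸ I) :=
  (restrictSupport K P).map (Ideal.Quotient.mkₐ K I).toLinearMap

theorem monomialSpan_eq_span (I : Ideal (MvPolynomial (Fin n) K)) (P : Set (Fin n →₀ ℕ)) :
    monomialSpan I P = Submodule.span K ((fun a => Ideal.Quotient.mk I (monomial a 1)) '' P) := by
  rw [monomialSpan, restrictSupport_eq_span, Submodule.map_span, Set.image_image]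
  rfl

theorem monomialSpan_mono (I : Ideal (MvPolynomial (Fin n) K)) {P Q : Set (Fin n →₀ ℕ)}
    (h : P ⊆ Q) : monomialSpan I P ≤ monomialSpan I Q :=
  Submodule.map_mono (restrictSupport_mono K h)

/-- A partition of the monomials outside a monomial ideal decomposes the quotient ring. -/
theorem isInternal_monomialSpan (h : IsMinimallyGeneratedBy I v) {ι : Type*} [DecidableEq ι]
    (P : ι → Set (Fin n →₀ ℕ)) (hex : ∀ a, (¬∃ i, v i ≤ a) → ∃ t, a ∈ P t)
    (huniq : ∀ a, (¬∃ i, v i ≤ a) → ∀ s t, a ∈ P s → a ∈ P t → s = t) :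
    DirectSum.IsInternal fun t => monomialSpan I (P t) := by
  refine DirectSum.isInternal_submodule_of_iSupIndep_of_iSup_eq_top ?_ ?_
  · intro t
    rw [Submodule.disjoint_def]
    intro x hx hx'
    have hle : ⨆ s, ⨆ (_ : s ≠ t), monomialSpan I (P s) ≤
        monomialSpan I (⋃ s, ⋃ (_ : s ≠ t), P s) :=
      iSup₂_le fun s hs => monomialSpan_mono I (Set.subset_iUnion₂_of_subset s hs subset_rfl)
    obtain ⟨f, hf, rfl⟩ := hx
    obtain ⟨g, hg, hgf⟩ := hle hx'
    have hsub : g - f ∈ I := Ideal.Quotient.eq.1 hgf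
    -- A monomial of f outside I cannot occur in g, whose exponents lie in the other classes, so it
    -- would survive in g - f ∈ I.
    refine Ideal.Quotient.eq_zero_iff_mem.2 (h.mem_iff.2 fun a ha => ?_)
    by_contra hE
    have hga : a ∉ g.support := fun hga => by
      obtain ⟨s, hs, has⟩ := Set.mem_iUnion₂.1 (hg hga)
      exact hs (huniq a hE s t has (hf ha))
    refine hE (h.mem_iff.1 hsub a ?_)
    rw [mem_support_iff] at ha ⊢
    rw [notMem_support_iff] at hga
    rw [coeff_sub, hga, zero_sub]
    exact neg_ne_zero.2 ha
  · rw [eq_top_iff]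
    rintro x -
    obtain ⟨f, rfl⟩ := Ideal.Quotient.mk_surjective x
    rw [f.as_sum, map_sum]
    refine sum_mem fun a _ => ?_
    by_cases hE : ∃ i, v i ≤ a
    · have : monomial a (coeff a f) ∈ I := h.mem_iff.2 fun b hb => by
        obtain rfl := Finset.mem_singleton.1 (support_monomial_subset hb)
        exact hE
      rw [Ideal.Quotient.eq_zero_iff_mem.2 this]
      exact zero_mem _
    · obtain ⟨t, ht⟩ := hex a hE
      exact Submodule.mem_iSup_of_mem t ⟨monomial a (coeff a f), by simp [ht], rfl⟩

theorem quotientGrading_eq_monomialSpan (I : Ideal (MvPolynomial (Fin n) K)) (j : ℕ) :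
    quotientGrading I j = monomialSpan I {a | a.degree = j} := by
  rw [quotientGrading, homogeneousSubmodule_eq_finsupp_supported]
  rfl

theorem isGradedModule_quotientGrading (h : IsMinimallyGeneratedBy I v) :
    IsGradedModule (n := n) (quotientGrading I) := by
  constructor
  · simp only [funext (quotientGrading_eq_monomialSpan I)]
    exact isInternal_monomialSpan h _ (fun a _ => ⟨a.degree, rfl⟩)
      fun a _ s t hs ht => hs.symm.trans ht
  · rintro i j f hf _ ⟨g, hg, rfl⟩
    exact ⟨f * g, IsHomogeneous.mul hf hg, map_mul (Ideal.Quotient.mk I) f g⟩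

theorem supported_eq_restrictSupport (Z : Set (Fin n)) :
    Subalgebra.toSubmodule (supported K Z) = restrictSupport K {b | ↑b.support ⊆ Z} := by
  ext f
  rw [Subalgebra.mem_toSubmodule, mem_supported, mem_restrictSupport_iff]
  constructor
  · intro hf b hb k hk
    exact hf ((mem_vars_iff_mem_support k).2 ⟨b, hb, hk⟩)
  · intro hf k hk
    obtain ⟨b, hb, hbk⟩ := (mem_vars_iff_mem_support k).1 hk
    exact hf hb hbk

theorem map_mulMonomial_supported (I : Ideal (MvPolynomial (Fin n) K)) (a : Fin n →₀ ℕ)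
    (Z : Set (Fin n)) :
    (Subalgebra.toSubmodule (supported K Z)).map (mulMonomial I a) =
      monomialSpan I ((fun b => a + b) '' {b | ↑b.support ⊆ Z}) := by
  rw [monomialSpan_eq_span, supported_eq_restrictSupport, restrictSupport_eq_span,
    Submodule.map_span, Set.image_image, Set.image_image]
  congr 1
  refine Set.image_congr fun b _ => ?_
  change Ideal.Quotient.mk I (monomial a 1 * monomial b 1) = _
  rw [monomial_mul, mul_one]

theorem injOn_mulMonomial (h : IsMinimallyGeneratedBy I v) {a : Fin n →₀ ℕ} {Z : Set (Fin n)}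
    (haZ : ∀ b : Fin n →₀ ℕ, ↑b.support ⊆ Z → ¬∃ i, v i ≤ a + b) :
    Set.InjOn (mulMonomial I a) (supported K Z) := by
  intro f hf g hg hfg
  have hsub : f - g ∈ restrictSupport K {b : Fin n →₀ ℕ | ↑b.support ⊆ Z} := by
    rw [← supported_eq_restrictSupport]
    exact sub_mem hf hg
  have hmem : monomial a 1 * f - monomial a 1 * g ∈ I := Ideal.Quotient.eq.1 hfg
  rw [← mul_sub, h.mem_iff] at hmem
  rw [← sub_eq_zero]
  by_contra hne
  obtain ⟨b, hb⟩ := ne_zero_iff.1 hne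
  refine haZ b (hsub (mem_support_iff.2 hb)) (hmem (a + b) ?_)
  rw [mem_support_iff, coeff_monomial_mul, one_mul]
  exact hb

end Decomposition

/-! ### Stanley depth. -/

section StanleyDepth

variable {K : Type u} [Field K] {n m : ℕ} {I : Ideal (MvPolynomial (Fin n) K)}
  {v : Fin m → (Fin n →₀ ℕ)}

theorem injective_of_apply_ne_zero (hd : ∀ i j k, v i k ≠ 0 → v j k ≠ 0 → i = j)
    {s : Fin m → Fin n} (hs : ∀ i, v i (s i) ≠ 0) : Function.Injective s := fun i j hij =>
  hd i j (s i) (hs i) (hij ▸ hs j)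

/-- The base point of the Stanley space indexed by `t`. -/
noncomputable def stanleyBase (v : Fin m → (Fin n →₀ ℕ)) (t : Fin m → Fin n × ℕ) : Fin n →₀ ℕ :=
  Finsupp.equivFunOnFinite.symm fun k =>
    ∑ i, if k < (t i).1 then v i k else if k = (t i).1 then (t i).2 else 0

theorem stanleyBase_apply (hd : ∀ i j k, v i k ≠ 0 → v j k ≠ 0 → i = j) {t : Fin m → Fin n × ℕ}
    (ht : ∀ i, (t i).2 < v i (t i).1) {i : Fin m} {k : Fin n} (hk : v i k ≠ 0) :
    stanleyBase v t k = if k < (t i).1 then v i k else if k = (t i).1 then (t i).2 else 0 := by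
  rw [stanleyBase, Finsupp.equivFunOnFinite_symm_apply_apply]
  refine Finset.sum_eq_single i (fun j _ hji => ?_) (by simp)
  have hj : v j k = 0 := by
    by_contra hj
    exact hji (hd j i k hj hk)
  have hne : k ≠ (t j).1 := by
    rintro rfl
    have := ht j
    omega
  rw [hj, if_neg hne, ite_self]

theorem stanleyBase_apply_of_eq_zero {t : Fin m → Fin n × ℕ}
    (ht : ∀ i, (t i).2 < v i (t i).1) {k : Fin n} (hk : ∀ i, v i k = 0) :
    stanleyBase v t k = 0 := by
  rw [stanleyBase, Finsupp.equivFunOnFinite_symm_apply_apply]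
  refine Finset.sum_eq_zero fun j _ => ?_
  have hne : k ≠ (t j).1 := by
    rintro rfl
    have := ht j
    have := hk j
    omega
  rw [hk j, if_neg hne, ite_self]

/-- Here `t i` records the first variable in which a monomial is smaller than the i-th generator,
and its exponent there. By coprimality the nontrivial conditions for different i concern different
variables, so together they cut out a translate of the monomials in the unrecorded variables. -/
theorem mem_stanleySpace_iff (hd : ∀ i j k, v i k ≠ 0 → v j k ≠ 0 → i = j)
    {t : Fin m → Fin n × ℕ} (ht : ∀ i, (t i).2 < v i (t i).1) (a : Fin n →₀ ℕ) :
    a ∈ (fun b => stanleyBase v t + b) ''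
        {b : Fin n →₀ ℕ | ↑b.support ⊆ ((Finset.univ.image fun i => (t i).1)ᶜ : Set (Fin n))} ↔
      ∀ i, (∀ k < (t i).1, v i k ≤ a k) ∧ a (t i).1 = (t i).2 := by
  have hbase : ∀ i, stanleyBase v t (t i).1 = (t i).2 := fun i => by
    rw [stanleyBase_apply hd ht (i := i) (by have := ht i; omega)]
    simp
  constructor
  · rintro ⟨b, hb, rfl⟩ i
    constructor
    · intro k hk
      by_cases h0 : v i k = 0
      · rw [h0]
        exact Nat.zero_le _
      · rw [Finsupp.add_apply, stanleyBase_apply hd ht h0, if_pos hk]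
        exact Nat.le_add_right _ _
    · have : b (t i).1 = 0 := by
        by_contra hne
        exact hb (Finsupp.mem_support_iff.2 hne) (by simp)
      rw [Finsupp.add_apply, hbase, this, add_zero]
  · intro ha
    have hle : stanleyBase v t ≤ a := fun k => by
      by_cases h0 : ∀ i, v i k = 0
      · rw [stanleyBase_apply_of_eq_zero ht h0]
        exact Nat.zero_le _
      · push Not at h0
        obtain ⟨i, hi⟩ := h0
        rw [stanleyBase_apply hd ht hi]
        split_ifs with h1 h2
        · exact (ha i).1 k h1
        · rw [h2, (ha i).2]
        · exact Nat.zero_le _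
    refine ⟨a - stanleyBase v t, fun k hk => ?_, add_tsub_cancel_of_le hle⟩
    intro hk'
    obtain ⟨i, -, rfl⟩ := Finset.mem_image.1 (Finset.mem_coe.1 hk')
    refine Finsupp.mem_support_iff.1 hk ?_
    rw [Finsupp.tsub_apply, hbase, (ha i).2, Nat.sub_self]

theorem exists_isStanleyDecomposition (h : IsMinimallyGeneratedBy I v) (hv : ∀ i, v i ≠ 0)
    (hd : ∀ i j k, v i k ≠ 0 → v j k ≠ 0 → i = j) :
    ∃ (r : ℕ) (a : Fin r → (Fin n →₀ ℕ)) (Z : Fin r → Finset (Fin n)),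
      IsStanleyDecomposition I a Z ∧ IsLeast (Set.range fun i => (Z i).card) (n - m) := by
  classical
  let T := {t : Fin m → Fin n × ℕ // ∀ i, (t i).2 < v i (t i).1}
  have hfin : Finite T := by
    refine Set.Finite.to_subtype (Set.Finite.subset (Set.Finite.pi fun i : Fin m =>
      ((Set.finite_univ (α := Fin n)).prod (Set.finite_Iio (∑ k, v i k)))) ?_)
    intro t ht i _
    exact ⟨trivial, (ht i).trans_le (Finset.single_le_sum (f := fun k => v i k)
      (fun _ _ => Nat.zero_le _) (Finset.mem_univ _))⟩
  -- Some Stanley space must exist for the minimum n - m to be attained.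
  have hne : Nonempty T := by
    choose s hs using fun i => Finsupp.ne_iff.1 (hv i)
    exact ⟨⟨fun i => (s i, 0), fun i => Nat.pos_of_ne_zero (hs i)⟩⟩
  obtain ⟨r, ⟨e⟩⟩ := Finite.exists_equiv_fin T
  let Z : T → Finset (Fin n) := fun t => (Finset.univ.image fun i => (t.1 i).1)ᶜ
  have hZ : ∀ t, ((Z t : Finset (Fin n)) : Set (Fin n)) =
      ((Finset.univ.image fun i => (t.1 i).1 : Finset (Fin n)) : Set (Fin n))ᶜ := fun t =>
    Finset.coe_compl _
  have hcard : ∀ t, (Z t).card = n - m := fun t => by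
    rw [Finset.card_compl, Finset.card_image_of_injective, Finset.card_univ, Fintype.card_fin,
      Fintype.card_fin]
    refine injective_of_apply_ne_zero hd fun i => ?_
    have := t.2 i
    omega
  refine ⟨r, fun l => stanleyBase v (e.symm l).1, fun l => Z (e.symm l), ⟨?_, ?_⟩, ?_⟩
  · intro l
    refine injOn_mulMonomial h fun b hb => ?_
    rintro ⟨i, hi⟩
    rw [hZ] at hb
    have := ((mem_stanleySpace_iff hd (e.symm l).2 _).1 ⟨b, hb, rfl⟩ i).2
    have h2 := hi ((e.symm l).1 i).1
    have h3 := (e.symm l).2 i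
    exact absurd (h2.trans_eq this) (not_le.2 h3)
  · simp only [map_mulMonomial_supported]
    refine isInternal_monomialSpan h _ ?_ ?_
    · intro a ha
      have hmin : ∀ i, ∃ k, a k < v i k ∧ ∀ l < k, v i l ≤ a l := fun i => by
        obtain ⟨k, hk⟩ : ∃ k, a k < v i k := by
          by_contra hcon
          push Not at hcon
          exact ha ⟨i, hcon⟩
        obtain ⟨k, hk, hk'⟩ := WellFounded.has_min (wellFounded_lt (α := Fin n))
          {k | a k < v i k} ⟨k, hk⟩
        exact ⟨k, hk, fun l hl => not_lt.1 fun hlt => hk' l hlt hl⟩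
      choose s hs hs' using hmin
      refine ⟨e ⟨fun i => (s i, a (s i)), hs⟩, ?_⟩
      rw [hZ, mem_stanleySpace_iff hd (e.symm _).2, Equiv.symm_apply_apply]
      exact fun i => ⟨hs' i, rfl⟩
    · intro a _ l l' hl hl'
      rw [hZ, mem_stanleySpace_iff hd (e.symm _).2] at hl hl'
      apply e.symm.injective
      refine Subtype.ext (funext fun i => ?_)
      have h1 := (e.symm l).2 i
      have h2 := (e.symm l').2 i
      -- If the recorded variables differed, the later record would make the exponent at the earlier
      -- one at least that of the generator.
      have hfst : ((e.symm l).1 i).1 = ((e.symm l').1 i).1 := by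
        rcases lt_trichotomy ((e.symm l).1 i).1 ((e.symm l').1 i).1 with hlt | heq | hlt
        · have := (hl' i).1 _ hlt
          have := (hl i).2
          omega
        · exact heq
        · have := (hl i).1 _ hlt
          have := (hl' i).2
          omega
      refine Prod.ext hfst ?_
      rw [← (hl i).2, ← (hl' i).2, hfst]
  · obtain ⟨t⟩ := hne
    refine ⟨⟨e t, hcard _⟩, ?_⟩
    rintro _ ⟨l, rfl⟩
    exact (hcard _).ge

/-- A generator lying in K[Z] would be sent to zero. So Z misses a variable of every generator, and
these m variables are distinct. -/
theorem card_le_of_injOn_mulMonomial (h : IsMinimallyGeneratedBy I v)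
    (hd : ∀ i j k, v i k ≠ 0 → v j k ≠ 0 → i = j) {a : Fin n →₀ ℕ} {Z : Finset (Fin n)}
    (hinj : Set.InjOn (mulMonomial I a) (supported K (Z : Set (Fin n)))) : Z.card ≤ n - m := by
  classical
  have hex : ∀ i, ∃ k, v i k ≠ 0 ∧ k ∉ Z := fun i => by
    by_contra hcon
    push Not at hcon
    have hmem : monomial (v i) (1 : K) ∈ supported K (Z : Set (Fin n)) := by
      rw [← Subalgebra.mem_toSubmodule, supported_eq_restrictSupport, monomial_mem_restrictSupport]
      exact Or.inl fun k hk => hcon k (Finsupp.mem_support_iff.1 hk)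
    have := hinj hmem (zero_mem _) (by
      rw [map_zero]
      refine Ideal.Quotient.eq_zero_iff_mem.2 (Ideal.mul_mem_left _ _ ?_)
      exact h.monomial_mem_iff.2 ⟨i, le_rfl⟩)
    exact one_ne_zero (monomial_eq_zero.1 this)
  choose s hs hsZ using hex
  have hsub : Finset.univ.image s ⊆ Zᶜ := fun k hk => by
    obtain ⟨i, -, rfl⟩ := Finset.mem_image.1 hk
    exact Finset.mem_compl.2 (hsZ i)
  have := Finset.card_le_card hsub
  rw [Finset.card_image_of_injective _ (injective_of_apply_ne_zero hd hs), Finset.card_compl,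
    Finset.card_univ, Fintype.card_fin, Fintype.card_fin] at this
  have := card_finset_fin_le Z
  omega

theorem isStanleyDepth (h : IsMinimallyGeneratedBy I v) (hv : ∀ i, v i ≠ 0)
    (hd : ∀ i j k, v i k ≠ 0 → v j k ≠ 0 → i = j) : IsStanleyDepth I (n - m) := by
  refine ⟨exists_isStanleyDecomposition h hv hd, ?_⟩
  rintro s ⟨r, a, Z, hD, ⟨⟨l, rfl⟩, -⟩⟩
  exact card_le_of_injOn_mulMonomial h hd (hD.1 l)

end StanleyDepth

end HilbertDepth

namespace HilbertDepth

open MvPolynomial RingTheory.Sequence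

/-! ### Regular sequences on a quotient ring. -/

section Quotient

theorem mk_mem_smul_top_iff {R : Type*} [CommRing R] (I J : Ideal R) (x : R) :
    Ideal.Quotient.mk I x ∈ (J • ⊤ : Submodule R (R ⧸ I)) ↔ x ∈ I ⊔ J := by
  have h1 : (J • ⊤ : Submodule R (R ⧸ I)) = Submodule.map (Submodule.mkQ I) J := by
    rw [← Submodule.range_mkQ, ← Submodule.map_top, ← Submodule.map_smul'', smul_eq_mul,
      Ideal.mul_top]
  rw [h1, ← Submodule.comap_map_mkQ, Submodule.mem_comap]
  rfl

theorem isRegular_quotient {R : Type*} [CommRing R] (I : Ideal R) (fs : List R)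
    (h : ∀ k (hk : k < fs.length), ∀ x, fs[k] * x ∈ I ⊔ Ideal.ofList (fs.take k) →
      x ∈ I ⊔ Ideal.ofList (fs.take k)) (htop : I ⊔ Ideal.ofList fs ≠ ⊤) :
    IsRegular (R ⧸ I) fs := by
  refine ⟨⟨fun k hk => ?_⟩, fun heq => htop ?_⟩
  · rw [isSMulRegular_quotient_iff_mem_of_smul_mem]
    intro y hy
    obtain ⟨x, rfl⟩ := Ideal.Quotient.mk_surjective y
    rw [mk_mem_smul_top_iff]
    exact h k hk x ((mk_mem_smul_top_iff _ _ _).1 hy)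
  · rw [Ideal.eq_top_iff_one, ← mk_mem_smul_top_iff, ← heq]
    trivial

end Quotient

/-! ### Linear forms that are nonzerodivisors modulo a monomial ideal. -/

section MonomialIdeal

variable {K : Type u} [Field K] {n m : ℕ}

theorem mem_span_range_monomial_iff (w : Fin m → (Fin n →₀ ℕ)) {f : MvPolynomial (Fin n) K} :
    f ∈ Ideal.span (Set.range fun i => monomial (w i) (1 : K)) ↔
      ∀ a ∈ f.support, ∃ i, w i ≤ a := by
  rw [show (Set.range fun i => monomial (w i) (1 : K)) =
    (fun s => monomial s (1 : K)) '' Set.range w from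
      Set.range_comp (fun s => monomial s (1 : K)) w, mem_ideal_span_monomial_image]
  simp

theorem mem_of_X_mul_mem (w : Fin m → (Fin n →₀ ℕ)) {k : Fin n} (hk : ∀ i, w i k = 0)
    {f : MvPolynomial (Fin n) K}
    (hf : X k * f ∈ Ideal.span (Set.range fun i => monomial (w i) (1 : K))) :
    f ∈ Ideal.span (Set.range fun i => monomial (w i) (1 : K)) := by
  rw [mem_span_range_monomial_iff] at hf ⊢
  intro a ha
  obtain ⟨i, hi⟩ := hf (Finsupp.single k 1 + a) (by
    rw [mem_support_iff, coeff_X_mul]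
    exact mem_support_iff.1 ha)
  refine ⟨i, fun l => ?_⟩
  have := hi l
  by_cases hl : l = k
  · rw [hl, hk i]
    exact Nat.zero_le _
  · rwa [Finsupp.add_apply, Finsupp.single_eq_of_ne hl, zero_add] at this

/-- In the product, x^u x_k can cancel only against the monomial x^u x_k / x_l of f. Its exponent in
x_k exceeds the maximum, so it would lie in the ideal, and x^u x_k with it. -/
theorem exists_le_add_single_of_X_sub_X_mul_mem (w : Fin m → (Fin n →₀ ℕ)) {k l : Fin n}
    (hkl : k ≠ l) {f : MvPolynomial (Fin n) K}
    (hf : (X k - X l) * f ∈ Ideal.span (Set.range fun i => monomial (w i) (1 : K)))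
    {u : Fin n →₀ ℕ} (hu : u ∈ f.support)
    (hmax : ∀ b ∈ f.support, (¬∃ i, w i ≤ b) → b k ≤ u k) :
    ∃ i, w i ≤ u + Finsupp.single k 1 := by
  classical
  by_contra hE
  refine hE ((mem_span_range_monomial_iff w).1 hf _ ?_)
  rw [mem_support_iff, sub_mul, coeff_sub, add_comm u, coeff_X_mul, coeff_X_mul']
  split_ifs with hl
  · have hz : coeff (Finsupp.single k 1 + u - Finsupp.single l 1) f = 0 := by
      by_contra hne
      have := hmax _ (mem_support_iff.2 hne) (fun ⟨i, hi⟩ => hE ⟨i, by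
        rw [add_comm]
        exact hi.trans tsub_le_self⟩)
      rw [Finsupp.tsub_apply, Finsupp.add_apply, Finsupp.single_eq_same,
        Finsupp.single_eq_of_ne hkl] at this
      omega
    rw [hz, sub_zero]
    exact mem_support_iff.1 hu
  · rw [sub_zero]
    exact mem_support_iff.1 hu

/-- Among the monomials of f outside the ideal let p be maximal in x_k and q in x_l. Both p x_k and
q x_l are divisible by the only generator that may involve x_k or x_l. Comparing exponents of x_k
gives `w i k ≤ q k ≤ p k < w i k`. -/
theorem mem_of_X_sub_X_mul_mem (w : Fin m → (Fin n →₀ ℕ)) {k l : Fin n} (hkl : k ≠ l)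
    {i : Fin m} (hi : ∀ j ≠ i, w j k = 0 ∧ w j l = 0) {f : MvPolynomial (Fin n) K}
    (hf : (X k - X l) * f ∈ Ideal.span (Set.range fun i => monomial (w i) (1 : K))) :
    f ∈ Ideal.span (Set.range fun i => monomial (w i) (1 : K)) := by
  classical
  have hf' : (X l - X k) * f ∈ Ideal.span (Set.range fun i => monomial (w i) (1 : K)) := by
    rw [← neg_sub, neg_mul]
    exact neg_mem hf
  have generator_eq : ∀ (a : Fin n →₀ ℕ) (q : Fin n), (∀ j ≠ i, w j q = 0) → (¬∃ j, w j ≤ a) →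
      (∃ j, w j ≤ a + Finsupp.single q 1) →
      w i ≤ a + Finsupp.single q 1 ∧ a q < w i q := by
    rintro a q hq ha ⟨j, hj⟩
    have hlt : a q < w j q := by
      by_contra hle
      refine ha ⟨j, fun t => ?_⟩
      by_cases ht : t = q
      · rw [ht]
        exact not_lt.1 hle
      · have := hj t
        rwa [Finsupp.add_apply, Finsupp.single_eq_of_ne ht, add_zero] at this
    obtain rfl : j = i := by
      by_contra hne
      have := hq j hne
      omega
    exact ⟨hj, hlt⟩
  rw [mem_span_range_monomial_iff]
  by_contra hcon
  push Not at hcon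
  obtain ⟨a, ha, haE⟩ := hcon
  let B := f.support.filter fun b => ¬∃ j, w j ≤ b
  have hB : B.Nonempty := ⟨a, Finset.mem_filter.2 ⟨ha, fun ⟨j, hj⟩ => haE j hj⟩⟩
  obtain ⟨p, hp, hpmax⟩ := B.exists_max_image (fun b => b k) hB
  obtain ⟨q, hq, hqmax⟩ := B.exists_max_image (fun b => b l) hB
  rw [Finset.mem_filter] at hp hq
  have h1 := generator_eq p k (fun j hj => (hi j hj).1) hp.2
    (exists_le_add_single_of_X_sub_X_mul_mem w hkl hf hp.1
      fun b hb hb' => hpmax b (Finset.mem_filter.2 ⟨hb, hb'⟩))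
  have h2 := generator_eq q l (fun j hj => (hi j hj).2) hq.2
    (exists_le_add_single_of_X_sub_X_mul_mem w hkl.symm hf' hq.1
      fun b hb hb' => hqmax b (Finset.mem_filter.2 ⟨hb, hb'⟩))
  have h3 := h2.1 k
  rw [Finsupp.add_apply, Finsupp.single_eq_of_ne hkl, add_zero] at h3
  have h4 := hpmax q (Finset.mem_filter.2 hq)
  have h5 := h1.2
  omega

end MonomialIdeal

/-! ### A regular sequence of n - m linear forms on S/I. -/

section DepthLowerBound

variable {K : Type u} [Field K] {n m : ℕ} {I : Ideal (MvPolynomial (Fin n) K)}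
  {v : Fin m → (Fin n →₀ ℕ)}

open Classical in
/-- The variable or zero that the variable `x_k` is identified with: the chosen variable `x_(s i)`
if `x_k` divides the `i`-th monomial, and zero if `x_k` divides none of the monomials. -/
noncomputable def specialValue (K : Type u) [Field K] (v : Fin m → (Fin n →₀ ℕ))
    (s : Fin m → Fin n) (k : Fin n) : MvPolynomial (Fin n) K :=
  if h : ∃ i, v i k ≠ 0 then X (s h.choose) else 0

theorem specialValue_eq (hd : ∀ i j k, v i k ≠ 0 → v j k ≠ 0 → i = j) (s : Fin m → Fin n)
    {i : Fin m} {k : Fin n} (hk : v i k ≠ 0) : specialValue K v s k = X (s i) := by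
  have h : ∃ i, v i k ≠ 0 := ⟨i, hk⟩
  rw [specialValue, dif_pos h, hd _ _ _ h.choose_spec hk]

/-- The substitution of `specialValue` for the variables with indices in `A`. -/
noncomputable def specialize (K : Type u) [Field K] (v : Fin m → (Fin n →₀ ℕ))
    (s : Fin m → Fin n) (A : Finset (Fin n)) :
    MvPolynomial (Fin n) K →ₐ[K] MvPolynomial (Fin n) K :=
  aeval fun k => if k ∈ A then specialValue K v s k else X k

/-- The exponent of the image of the `i`-th monomial under `specialize`. -/
noncomputable def specialExponent (v : Fin m → (Fin n →₀ ℕ)) (s : Fin m → Fin n)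
    (A : Finset (Fin n)) (i : Fin m) : Fin n →₀ ℕ :=
  (v i).mapDomain fun k => if k ∈ A then s i else k

theorem specialExponent_apply {s : Fin m → Fin n} {A : Finset (Fin n)} {i : Fin m} {k : Fin n}
    (hkA : k ∉ A) (hki : k ≠ s i) : specialExponent v s A i k = v i k := by
  classical
  rw [specialExponent, Finsupp.mapDomain, Finsupp.sum_apply, Finsupp.sum,
    Finset.sum_eq_single k]
  · rw [if_neg hkA, Finsupp.single_eq_same]
  · intro l _ hlk
    rw [Finsupp.single_apply, if_neg]
    split_ifs with h
    · exact hki.symm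
    · exact hlk
  · intro hk
    rw [Finsupp.notMem_support_iff.1 hk, Finsupp.single_zero, Finsupp.zero_apply]

theorem specialize_X_of_notMem {s : Fin m → Fin n} {A : Finset (Fin n)} {k : Fin n} (hk : k ∉ A) :
    specialize K v s A (X k) = X k := by
  rw [specialize, aeval_X, if_neg hk]

theorem specialize_specialValue {s : Fin m → Fin n} {A : Finset (Fin n)} (hA : ∀ i, s i ∉ A)
    (k : Fin n) : specialize K v s A (specialValue K v s k) = specialValue K v s k := by
  rw [specialValue]
  split_ifs with h
  · exact specialize_X_of_notMem (hA _)
  · exact map_zero _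

theorem specialize_monomial (hd : ∀ i j k, v i k ≠ 0 → v j k ≠ 0 → i = j) (s : Fin m → Fin n)
    (A : Finset (Fin n)) (i : Fin m) :
    specialize K v s A (monomial (v i) 1) = monomial (specialExponent v s A i) 1 := by
  rw [specialExponent, ← rename_monomial, rename_eq_aeval, specialize, aeval_monomial, aeval_monomial]
  congr 1
  refine Finsupp.prod_congr fun k hk => ?_
  rw [specialValue_eq hd s (Finsupp.mem_support_iff.1 hk), Function.comp_apply]
  split_ifs <;> rfl

/-- The substitution is the identity modulo the forms x_k - value, and it kills these forms because
the chosen variables are left fixed. Working modulo I and the forms thus becomes working modulo a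
monomial ideal. -/
theorem mem_sup_span_iff (h : IsMinimallyGeneratedBy I v)
    (hd : ∀ i j k, v i k ≠ 0 → v j k ≠ 0 → i = j) {s : Fin m → Fin n} {A : Finset (Fin n)}
    (hA : ∀ i, s i ∉ A) (f : MvPolynomial (Fin n) K) :
    f ∈ I ⊔ Ideal.span ((fun k => X k - specialValue K v s k) '' A) ↔
      specialize K v s A f ∈
        Ideal.span (Set.range fun i => monomial (specialExponent v s A i) (1 : K)) := by
  set L := Ideal.span ((fun k => X k - specialValue K v s k) '' (A : Set (Fin n))) with hL
  have hsub : ∀ g, specialize K v s A g - g ∈ L := by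
    intro g
    rw [← Ideal.Quotient.eq]
    change ((Ideal.Quotient.mkₐ K L).comp (specialize K v s A)) g = Ideal.Quotient.mkₐ K L g
    congr 1
    refine algHom_ext fun k => ?_
    change Ideal.Quotient.mk L (specialize K v s A (X k)) = Ideal.Quotient.mk L (X k)
    rw [Ideal.Quotient.eq, specialize, aeval_X]
    split_ifs with hk
    · rw [← neg_sub]
      exact neg_mem (Ideal.subset_span ⟨k, hk, rfl⟩)
    · rw [sub_self]
      exact zero_mem _
  constructor
  · intro hf
    refine (show I ⊔ L ≤ Ideal.comap (specialize K v s A) (Ideal.span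
      (Set.range fun i => monomial (specialExponent v s A i) (1 : K))) from ?_) hf
    rw [sup_le_iff, h.1, hL, Ideal.span_le, Ideal.span_le]
    constructor
    · rintro _ ⟨i, rfl⟩
      refine Ideal.mem_comap.2 ?_
      rw [specialize_monomial hd]
      exact Ideal.subset_span ⟨i, rfl⟩
    · rintro _ ⟨k, hk, rfl⟩
      refine Ideal.mem_comap.2 ?_
      rw [map_sub, specialize_specialValue hA, specialize, aeval_X, if_pos (Finset.mem_coe.1 hk), sub_self]
      exact zero_mem _
  · intro hf
    have hle : Ideal.span (Set.range fun i => monomial (specialExponent v s A i) (1 : K)) ≤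
        I ⊔ L := by
      rw [Ideal.span_le]
      rintro _ ⟨i, rfl⟩
      change monomial _ _ ∈ I ⊔ L
      rw [← specialize_monomial hd, ← sub_add_cancel (specialize K v s A _) (monomial (v i) 1)]
      exact add_mem (Ideal.mem_sup_right (hsub _))
        (Ideal.mem_sup_left (h.monomial_mem_iff.2 ⟨i, le_rfl⟩))
    have := sub_mem (hle hf) (Ideal.mem_sup_right (hsub f))
    rwa [sub_sub_cancel] at this

/-- After substitution the multiplier is a difference of two variables that occur in at most one
common generator and in no other, or a single variable that occurs in none. -/
theorem mem_of_X_sub_specialValue_mul_mem (h : IsMinimallyGeneratedBy I v)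
    (hd : ∀ i j k, v i k ≠ 0 → v j k ≠ 0 → i = j) {s : Fin m → Fin n} (hs : ∀ i, v i (s i) ≠ 0)
    {A : Finset (Fin n)} (hA : ∀ i, s i ∉ A) {k : Fin n} (hkA : k ∉ A) (hks : ∀ i, k ≠ s i)
    {f : MvPolynomial (Fin n) K}
    (hf : (X k - specialValue K v s k) * f ∈
      I ⊔ Ideal.span ((fun k => X k - specialValue K v s k) '' A)) :
    f ∈ I ⊔ Ideal.span ((fun k => X k - specialValue K v s k) '' A) := by
  rw [mem_sup_span_iff h hd hA] at hf ⊢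
  rw [map_mul, map_sub, specialize_X_of_notMem hkA, specialize_specialValue hA] at hf
  by_cases hk : ∃ i, v i k ≠ 0
  · obtain ⟨i, hi⟩ := hk
    rw [specialValue_eq hd s hi] at hf
    refine mem_of_X_sub_X_mul_mem _ (hks i) (i := i) (fun j hj => ⟨?_, ?_⟩) hf
    · rw [specialExponent_apply hkA (hks j)]
      by_contra hne
      exact hj (hd _ _ _ hne hi)
    · rw [specialExponent_apply (hA i) fun heq =>
        hj (injective_of_apply_ne_zero hd hs heq).symm]
      by_contra hne
      exact hj (hd _ _ _ hne (hs i))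
  · rw [specialValue, dif_neg hk, sub_zero] at hf
    refine mem_of_X_mul_mem _ (fun j => ?_) hf
    rw [specialExponent_apply hkA (hks j)]
    by_contra hne
    exact hk ⟨j, hne⟩

theorem specialValue_mem_idealOfVars (s : Fin m → Fin n) (k : Fin n) :
    specialValue K v s k ∈ idealOfVars (Fin n) K := by
  rw [specialValue]
  split_ifs
  · exact Ideal.subset_span ⟨_, rfl⟩
  · exact zero_mem _

theorem idealOfVars_ne_top : idealOfVars (Fin n) K ≠ ⊤ := by
  intro htop
  have h1 : idealOfVars (Fin n) K ≤ RingHom.ker (constantCoeff (R := K) (σ := Fin n)) := by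
    rw [idealOfVars, Ideal.span_le]
    rintro _ ⟨k, rfl⟩
    exact constantCoeff_X (R := K) k
  exact RingHom.ker_ne_top _ (top_le_iff.1 (htop ▸ h1))

theorem IsMinimallyGeneratedBy.le_idealOfVars (h : IsMinimallyGeneratedBy I v)
    (hv : ∀ i, v i ≠ 0) : I ≤ idealOfVars (Fin n) K := by
  rw [h.1, Ideal.span_le]
  rintro _ ⟨i, rfl⟩
  obtain ⟨k, hk⟩ := Finsupp.ne_iff.1 (hv i)
  refine Ideal.mem_of_dvd _ ?_ (Ideal.subset_span ⟨k, rfl⟩)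
  exact (X_dvd_monomial).2 (Or.inr hk)

/-- One form x_k - value is taken for each variable that was not chosen. -/
theorem exists_isRegular_quotient (h : IsMinimallyGeneratedBy I v) (hv : ∀ i, v i ≠ 0)
    (hd : ∀ i j k, v i k ≠ 0 → v j k ≠ 0 → i = j) :
    ∃ fs : List (MvPolynomial (Fin n) K), fs.length = n - m ∧
      (∀ f ∈ fs, f ∈ idealOfVars (Fin n) K) ∧ IsRegular (MvPolynomial (Fin n) K ⧸ I) fs := by
  classical
  choose s hs using fun i => Finsupp.ne_iff.1 (hv i)
  have hL : ∀ k ∈ (Finset.univ.image s)ᶜ.toList, ∀ i, k ≠ s i := fun k hk i hki => by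
    rw [Finset.mem_toList, Finset.mem_compl] at hk
    exact hk (Finset.mem_image.2 ⟨i, Finset.mem_univ _, hki.symm⟩)
  have hnodup := (Finset.univ.image s)ᶜ.nodup_toList
  have hlen : (Finset.univ.image s)ᶜ.toList.length = n - m := by
    rw [Finset.length_toList, Finset.card_compl,
      Finset.card_image_of_injective _ (injective_of_apply_ne_zero hd hs),
      Finset.card_univ, Fintype.card_fin, Fintype.card_fin]
  generalize (Finset.univ.image s)ᶜ.toList = L at hL hnodup hlen
  have hmem : ∀ f ∈ L.map fun k => X k - specialValue K v s k, f ∈ idealOfVars (Fin n) K := by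
    intro f hf
    obtain ⟨k, -, rfl⟩ := List.mem_map.1 hf
    exact sub_mem (Ideal.subset_span ⟨k, rfl⟩) (specialValue_mem_idealOfVars s k)
  refine ⟨L.map fun k => X k - specialValue K v s k, by rw [List.length_map, hlen], hmem,
    isRegular_quotient I _ (fun k hk x hx => ?_) ?_⟩
  · have hspan : Ideal.ofList ((L.map fun k => X k - specialValue K v s k).take k) =
        Ideal.span ((fun k => X k - specialValue K v s k) '' ((L.take k).toFinset : Set _)) := by
      rw [Ideal.ofList, ← List.map_take]
      congr 1
      ext f
      simp [-List.map_take]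
    rw [List.length_map] at hk
    rw [hspan] at hx ⊢
    rw [List.getElem_map] at hx
    refine mem_of_X_sub_specialValue_mul_mem h hd hs (fun i hi => ?_) ?_
      (hL _ (List.getElem_mem hk)) hx
    · exact hL _ (List.mem_of_mem_take (List.mem_toFinset.1 hi)) i rfl
    · rw [List.mem_toFinset, List.mem_take_iff_getElem]
      rintro ⟨j, hj, hjk⟩
      have := (hnodup.getElem_inj_iff).1 hjk
      omega
  · refine ne_top_of_le_ne_top (idealOfVars_ne_top (K := K) (n := n)) ?_
    exact sup_le (h.le_idealOfVars hv) (Ideal.span_le.2 hmem)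

end DepthLowerBound

end HilbertDepth

/-! ### Krull dimension. -/

namespace RegularSequence

open RingTheory.Sequence Module

/-- A regular element avoids the minimal primes of the annihilator, so each member lowers the
dimension by at least one. -/
theorem supportDim_quotient_add_length_le {R : Type*} [CommRing R] [IsNoetherianRing R]
    {M : Type*} [AddCommGroup M] [Module R M] [Module.Finite R M] (rs : List R)
    (reg : IsWeaklyRegular M rs) :
    supportDim R (M ⧸ (Ideal.ofList rs • ⊤ : Submodule R M)) + rs.length ≤ supportDim R M := by
  induction rs generalizing M with
  | nil =>
    rw [Ideal.ofList_nil, Submodule.bot_smul]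
    simpa using (supportDim_eq_of_equiv (Submodule.quotEquivOfEqBot (⊥ : Submodule R M) rfl)).le
  | cons x rs ih =>
    obtain ⟨h1, h2⟩ := (isWeaklyRegular_cons_iff M _ _).1 reg
    rw [supportDim_eq_of_equiv (Submodule.quotOfListConsSMulTopEquivQuotSMulTopInner M x rs),
      List.length_cons, Nat.cast_add, Nat.cast_one, ← add_assoc]
    exact (add_le_add_left (ih h2) 1).trans
      (supportDim_quotSMulTop_succ_le_of_notMem_minimalPrimes
        fun _ => h1.notMem_of_mem_minimalPrimes)

theorem ringKrullDim_quotient_add_length_le {R : Type*} [CommRing R] [IsNoetherianRing R]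
    (rs : List R) (reg : IsWeaklyRegular R rs) :
    ringKrullDim (R ⧸ Ideal.ofList rs) + rs.length ≤ ringKrullDim R := by
  have := supportDim_quotient_add_length_le rs reg
  rwa [smul_eq_mul, Ideal.mul_top, supportDim_quotient_eq_ringKrullDim,
    supportDim_self_eq_ringKrullDim] at this

end RegularSequence

namespace HilbertDepth

open MvPolynomial RingTheory.Sequence

section KrullDim

variable {K : Type u} [Field K] {n m : ℕ} {I : Ideal (MvPolynomial (Fin n) K)}
  {v : Fin m → (Fin n →₀ ℕ)}

/-- Killing one chosen variable per generator kills I and maps S/I onto a polynomial ring in n - m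
variables. -/
theorem le_ringKrullDim_quotient (h : IsMinimallyGeneratedBy I v) (hv : ∀ i, v i ≠ 0)
    (hd : ∀ i j k, v i k ≠ 0 → v j k ≠ 0 → i = j) :
    ((n - m : ℕ) : WithBot ℕ∞) ≤ ringKrullDim (MvPolynomial (Fin n) K ⧸ I) := by
  classical
  choose s hs using fun i => Finsupp.ne_iff.1 (hv i)
  let T := {k : Fin n // k ∉ Finset.univ.image s}
  let φ : MvPolynomial (Fin n) K →ₐ[K] MvPolynomial T K :=
    aeval fun k => if hk : k ∈ Finset.univ.image s then 0 else X ⟨k, hk⟩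
  have hI : ∀ f ∈ I, φ f = 0 := by
    intro f hf
    rw [f.as_sum, map_sum]
    refine Finset.sum_eq_zero fun a ha => ?_
    obtain ⟨i, hi⟩ := h.mem_iff.1 hf a ha
    rw [aeval_monomial, Finsupp.prod, Finset.prod_eq_zero (i := s i), mul_zero]
    · rw [Finsupp.mem_support_iff]
      have h1 := hi (s i)
      have h2 : v i (s i) ≠ 0 := hs i
      omega
    · rw [dif_pos (Finset.mem_image_of_mem s (Finset.mem_univ i)), zero_pow]
      have h1 := hi (s i)
      have h2 : v i (s i) ≠ 0 := hs i
      omega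
  have hsurj : Function.Surjective (Ideal.Quotient.lift I φ.toRingHom hI) := by
    apply Ideal.Quotient.lift_surjective_of_surjective
    change Function.Surjective φ
    rw [← AlgHom.range_eq_top, eq_top_iff, ← adjoin_range_X, Algebra.adjoin_le_iff]
    rintro _ ⟨⟨k, hk⟩, rfl⟩
    refine ⟨X k, ?_⟩
    change φ (X k) = _
    rw [aeval_X, dif_neg hk]
  have hle := ringKrullDim_le_of_surjective _ hsurj
  rw [ringKrullDim_of_isNoetherianRing, ringKrullDim_eq_zero_of_field, zero_add] at hle
  have hcard : Nat.card T = n - m := by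
    rw [Nat.card_eq_fintype_card, Fintype.card_subtype_compl, Fintype.card_fin,
      Fintype.card_coe, Finset.card_image_of_injective _ (injective_of_apply_ne_zero hd hs),
      Finset.card_univ, Fintype.card_fin]
  rwa [hcard] at hle

theorem le_of_apply_ne_zero (hv : ∀ i, v i ≠ 0)
    (hd : ∀ i j k, v i k ≠ 0 → v j k ≠ 0 → i = j) : m ≤ n := by
  choose s hs using fun i => Finsupp.ne_iff.1 (hv i)
  simpa using Fintype.card_le_of_injective s (injective_of_apply_ne_zero hd hs)

theorem ringKrullDim_quotient_eq (h : IsMinimallyGeneratedBy I v)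
    (hci : IsCompleteIntersection I) (hv : ∀ i, v i ≠ 0)
    (hd : ∀ i j k, v i k ≠ 0 → v j k ≠ 0 → i = j) :
    ringKrullDim (MvPolynomial (Fin n) K ⧸ I) = ((n - m : ℕ) : WithBot ℕ∞) := by
  refine le_antisymm ?_ (le_ringKrullDim_quotient h hv hd)
  obtain ⟨⟨fs, hfs, rfl, rfl⟩, -⟩ := IsCompleteIntersection.exists_isRegular h hci
  have hle := RegularSequence.ringKrullDim_quotient_add_length_le fs hfs
  rw [ringKrullDim_of_isNoetherianRing, ringKrullDim_eq_zero_of_field, zero_add, Nat.card_fin] at hle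
  have hmn := le_of_apply_ne_zero hv hd
  rw [← ENat.WithBot.add_le_add_natCast_right_iff (c := fs.length), ← Nat.cast_add,
    Nat.sub_add_cancel hmn]
  exact hle

end KrullDim

end HilbertDepth

/-! ### Polynomial independence along a regular sequence. -/

namespace RegularSequence

open RingTheory.Sequence MvPolynomial
open scoped Pointwise

theorem aeval_eq_eval₂_finSuccEquiv {K R : Type*} [Field K] [CommRing R] [Algebra K R] {l : ℕ}
    (g : Fin (l + 1) → R) (p : MvPolynomial (Fin (l + 1)) K) :
    aeval g p = (finSuccEquiv K l p).eval₂
      (aeval fun i => g i.succ : MvPolynomial (Fin l) K →ₐ[K] R).toRingHom (g 0) := by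
  induction p using MvPolynomial.induction_on with
  | C a =>
    rw [← algebraMap_eq, AlgEquiv.commutes, IsScalarTower.algebraMap_apply K
      (MvPolynomial (Fin l) K) (Polynomial _), Polynomial.algebraMap_eq, Polynomial.eval₂_C,
      AlgHom.toRingHom_eq_coe, RingHom.coe_coe, AlgHom.commutes, AlgHom.commutes]
  | add p q hp hq => rw [map_add, map_add, Polynomial.eval₂_add, hp, hq]
  | mul_X p i hp =>
    rw [map_mul, map_mul, Polynomial.eval₂_mul, hp, aeval_X]
    congr 1
    refine Fin.cases ?_ (fun i => ?_) i
    · rw [finSuccEquiv_X_zero, Polynomial.eval₂_X]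
    · rw [finSuccEquiv_X_succ, Polynomial.eval₂_C, AlgHom.toRingHom_eq_coe, RingHom.coe_coe,
        aeval_X]

/-- Some element of a module is annihilated by no nonzero polynomial in the members of a regular
sequence. -/
theorem exists_forall_aeval_smul_eq_zero (K : Type*) {R : Type*} [Field K] [CommRing R]
    [Algebra K R] (fs : List R) {M : Type*} [AddCommGroup M] [Module R M] (h : IsRegular M fs) :
    ∃ x : M, ∀ p : MvPolynomial (Fin fs.length) K, aeval (fun i => fs[i]) p • x = 0 → p = 0 := by
  induction fs generalizing M with
  | nil =>
    have := h.nontrivial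
    obtain ⟨x, hx⟩ := exists_ne (0 : M)
    refine ⟨x, fun p hp => ?_⟩
    obtain ⟨c, rfl⟩ := C_surjective (Fin 0) p
    by_contra hc
    have hc0 : c ≠ 0 := fun h0 => hc (by rw [h0, map_zero])
    rw [aeval_C] at hp
    apply hx
    rw [← one_smul R x, ← map_one (algebraMap K R), ← inv_mul_cancel₀ hc0, map_mul, mul_smul, hp,
      smul_zero]
  | cons f fs ih =>
    rw [isRegular_cons_iff] at h
    obtain ⟨y, hy⟩ := ih h.2
    obtain ⟨x, rfl⟩ := Submodule.mkQ_surjective _ y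
    refine ⟨x, fun p hp => ?_⟩
    rw [aeval_eq_eval₂_finSuccEquiv] at hp
    -- Modulo f only the constant coefficient of P acts on x; it kills y, so it is zero. Then f
    -- cancels, and `P.divX` has smaller degree unless P is constant.
    have key : ∀ d, ∀ P : Polynomial (MvPolynomial (Fin fs.length) K), P.natDegree < d →
        P.eval₂ (aeval fun i : Fin fs.length => fs[i] :
          MvPolynomial (Fin fs.length) K →ₐ[K] R).toRingHom f • x = 0 → P = 0 := by
      intro d
      induction d with
      | zero => exact fun P hP => absurd hP (Nat.not_lt_zero _)
      | succ d ihd =>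
        intro P hP hPx
        rw [← P.divX_mul_X_add, Polynomial.eval₂_add, Polynomial.eval₂_mul, Polynomial.eval₂_X,
          Polynomial.eval₂_C, mul_comm, add_smul, mul_smul] at hPx
        have hcoeff : P.coeff 0 = 0 := by
          apply hy
          have h1 := congrArg (Submodule.mkQ (f • ⊤ : Submodule R M)) hPx
          rw [map_add, map_zero, map_smul _ _ x] at h1
          refine Eq.trans (right_eq_add.2 ?_) h1
          refine (Submodule.Quotient.mk_eq_zero _).2 ?_
          exact Submodule.smul_mem_pointwise_smul _ _ _ trivial
        rw [hcoeff, map_zero, zero_smul, add_zero] at hPx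
        have hdiv := h.1.right_eq_zero_of_smul hPx
        have hdivX : P.divX = 0 := by
          by_cases h0 : P.natDegree = 0
          · rw [Polynomial.divX_eq_zero_iff]
            exact Polynomial.eq_C_of_natDegree_eq_zero h0
          · refine ihd _ ?_ hdiv
            rw [Polynomial.natDegree_divX_eq_natDegree_tsub_one]
            omega
        rw [← P.divX_mul_X_add, hdivX, hcoeff, zero_mul, map_zero, add_zero]
    have := key _ _ (Nat.lt_succ_self _) hp
    exact (map_eq_zero_iff _ (finSuccEquiv K fs.length).injective).1 this

end RegularSequence

namespace HilbertDepth

open MvPolynomial RingTheory.Sequence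

/-! ### Lower bound for the growth of the Hilbert function. -/

section Graded

variable {K : Type u} [Field K] {n : ℕ} {N : Type u} [AddCommGroup N] [Module K N]
  [Module (MvPolynomial (Fin n) K) N]
  {𝒩 : ℕ → Submodule K N}

/-- A finitely generated graded module is generated by finitely many homogeneous elements. -/
theorem IsGradedModule.exists_homogeneous_generators [IsScalarTower K (MvPolynomial (Fin n) K) N]
    [Module.Finite (MvPolynomial (Fin n) K) N]
    (h : IsGradedModule (n := n) 𝒩) :
    ∃ T : Finset N, (∀ x ∈ T, ∃ j, x ∈ 𝒩 j) ∧
      Submodule.span (MvPolynomial (Fin n) K) (T : Set N) = ⊤ := by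
  have htop : Submodule.span (MvPolynomial (Fin n) K) (⋃ j, (𝒩 j : Set N)) = ⊤ := by
    rw [eq_top_iff]
    rintro x -
    have hx : x ∈ ⨆ j, 𝒩 j := by
      rw [h.1.submodule_iSup_eq_top]
      trivial
    rw [Submodule.iSup_eq_span] at hx
    exact Submodule.span_le_restrictScalars K (MvPolynomial (Fin n) K) _ hx
  obtain ⟨T, hT, hspan⟩ := (Submodule.fg_span_iff_fg_span_finset_subset _).1
    (htop ▸ Module.Finite.fg_top)
  exact ⟨T, fun x hx => Set.mem_iUnion.1 (hT hx), by rw [← hspan, htop]⟩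

theorem monomial_smul_mem (h : IsGradedModule (n := n) 𝒩) (a : Fin n →₀ ℕ) (c : K) {j : ℕ} {x : N}
    (hx : x ∈ 𝒩 j) : monomial a c • x ∈ 𝒩 (a.degree + j) :=
  h.2 _ _ _ (isHomogeneous_monomial c rfl) _ hx

/-- Each component is spanned by the finitely many products, of the right degree, of a monomial with
a homogeneous generator. -/
theorem IsGradedModule.finite [IsScalarTower K (MvPolynomial (Fin n) K) N]
    [Module.Finite (MvPolynomial (Fin n) K) N]
    (h : IsGradedModule (n := n) 𝒩) (j : ℕ) : Module.Finite K (𝒩 j) := by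
  obtain ⟨T, hT, hspan⟩ := h.exists_homogeneous_generators
  choose! e he using hT
  let G : ℕ → Set N := fun j => {y | ∃ a : Fin n →₀ ℕ, ∃ x ∈ T, a.degree + e x = j ∧
    monomial a (1 : K) • x = y}
  have hG : ∀ j, (G j).Finite := fun j => by
    have hdeg : {a : Fin n →₀ ℕ | a.degree ≤ j}.Finite := by
      refine (Set.finite_Iic (Finsupp.equivFunOnFinite.symm fun _ => j)).subset fun a ha k => ?_
      exact (Finsupp.le_degree k a).trans ha
    refine ((hdeg.prod T.finite_toSet).image fun p => monomial p.1 (1 : K) • p.2).subset ?_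
    rintro y ⟨a, x, hx, hax, rfl⟩
    refine ⟨(a, x), ⟨?_, hx⟩, rfl⟩
    change a.degree ≤ j
    omega
  have hGle : ∀ j, Submodule.span K (G j) ≤ 𝒩 j := fun j => by
    rw [Submodule.span_le]
    rintro y ⟨a, x, hx, rfl, rfl⟩
    exact monomial_smul_mem h a 1 (he x hx)
  have htop : ⨆ j, Submodule.span K (G j) = ⊤ := by
    rw [eq_top_iff]
    rintro z -
    have hz : z ∈ Submodule.span (MvPolynomial (Fin n) K) (T : Set N) := hspan ▸ trivial
    rw [Submodule.mem_span_finset] at hz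
    obtain ⟨p, -, rfl⟩ := hz
    refine sum_mem fun x hx => ?_
    rw [(p x).as_sum, Finset.sum_smul]
    refine sum_mem fun a _ => Submodule.mem_iSup_of_mem (a.degree + e x) ?_
    rw [← mul_one (coeff a (p x)), ← smul_eq_mul, ← smul_monomial, smul_assoc]
    exact Submodule.smul_mem _ _ (Submodule.subset_span ⟨a, x, hx, rfl, rfl⟩)
  -- The spans lie in the components and together fill the module, so independence and the modular
  -- law force equality.
  have heq : 𝒩 j = Submodule.span K (G j) := by
    refine le_antisymm ?_ (hGle j)
    have hsup : Submodule.span K (G j) ⊔ ⨆ i, ⨆ (_ : i ≠ j), 𝒩 i = ⊤ := by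
      rw [eq_top_iff, ← htop]
      refine iSup_le fun i => ?_
      by_cases hij : i = j
      · rw [hij]
        exact le_sup_left
      · exact le_sup_of_le_right ((hGle i).trans (le_iSup₂_of_le i hij le_rfl))
    have hdisj := (h.1.submodule_iSupIndep j).eq_bot
    have := sup_inf_assoc_of_le (⨆ i, ⨆ (_ : i ≠ j), 𝒩 i) (hGle j)
    rw [hsup, top_inf_eq, inf_comm, hdisj, sup_bot_eq] at this
    exact this.le
  rw [heq]
  exact Module.Finite.span_of_finite K (hG j)

/-- The part of degree at most `J` of a graded module. -/
noncomputable def degreeLE (𝒩 : ℕ → Submodule K N) (J : ℕ) : Submodule K N :=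
  (Finset.range (J + 1)).sup 𝒩

theorem le_degreeLE (𝒩 : ℕ → Submodule K N) {j J : ℕ} (hj : j ≤ J) : 𝒩 j ≤ degreeLE 𝒩 J :=
  Finset.le_sup (f := 𝒩) (Finset.mem_range.2 (Nat.lt_succ_of_le hj))

theorem degreeLE_mono (𝒩 : ℕ → Submodule K N) {j J : ℕ} (hj : j ≤ J) :
    degreeLE 𝒩 j ≤ degreeLE 𝒩 J :=
  Finset.sup_mono (Finset.range_subset_range.2 (Nat.succ_le_succ hj))

theorem finite_degreeLE (h𝒩 : ∀ j, Module.Finite K (𝒩 j)) (J : ℕ) :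
    Module.Finite K (degreeLE 𝒩 J) :=
  Submodule.finiteDimensional_finset_sup _ _

theorem finrank_degreeLE_le (h𝒩 : ∀ j, Module.Finite K (𝒩 j)) (J : ℕ) :
    Module.finrank K (degreeLE 𝒩 J) ≤ ∑ j ∈ Finset.range (J + 1), Module.finrank K (𝒩 j) := by
  unfold degreeLE
  generalize J + 1 = t
  induction t with
  | zero =>
    rw [Finset.range_zero, Finset.sup_empty, finrank_bot]
    exact Nat.zero_le _
  | succ t ih =>
    have : Module.Finite K ((Finset.range t).sup 𝒩 : Submodule K N) :=
      Submodule.finiteDimensional_finset_sup _ _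
    rw [Finset.range_add_one, Finset.sup_insert, Finset.sum_insert Finset.notMem_range_self]
    exact (Submodule.finrank_add_le_finrank_add_finrank _ _).trans (Nat.add_le_add_left ih _)

theorem IsGradedModule.exists_mem_degreeLE (h : IsGradedModule (n := n) 𝒩) (x : N) :
    ∃ E, x ∈ degreeLE 𝒩 E := by
  have hx : x ∈ ⨆ j, 𝒩 j := by
    rw [h.1.submodule_iSup_eq_top]
    trivial
  induction hx using Submodule.iSup_induction' with
  | mem j x hx => exact ⟨j, le_degreeLE 𝒩 le_rfl hx⟩
  | zero => exact ⟨0, zero_mem _⟩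
  | add x y _ _ hx hy =>
    obtain ⟨E, hE⟩ := hx
    obtain ⟨F, hF⟩ := hy
    exact ⟨max E F, add_mem (degreeLE_mono 𝒩 (le_max_left _ _) hE)
      (degreeLE_mono 𝒩 (le_max_right _ _) hF)⟩

theorem IsGradedModule.smul_mem_degreeLE (h : IsGradedModule (n := n) 𝒩)
    {f : MvPolynomial (Fin n) K} {D E : ℕ} (hf : f.totalDegree ≤ D) {x : N}
    (hx : x ∈ degreeLE 𝒩 E) : f • x ∈ degreeLE 𝒩 (D + E) := by
  rw [degreeLE, Finset.sup_eq_iSup, iSup_subtype'] at hx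
  induction hx using Submodule.iSup_induction' with
  | mem j x hx =>
    rw [f.as_sum, Finset.sum_smul]
    refine sum_mem fun a ha => le_degreeLE 𝒩 ?_ (monomial_smul_mem h a _ hx)
    have h1 : a.degree ≤ f.totalDegree := le_totalDegree ha
    have h2 := Finset.mem_range.1 j.2
    omega
  | zero =>
    rw [smul_zero]
    exact zero_mem _
  | add x y _ _ hx hy =>
    rw [smul_add]
    exact add_mem hx hy

/-- The existence of a regular sequence of length `r` forces the Hilbert function to grow at least
like a polynomial of degree `r`. -/
theorem IsGradedModule.exists_pow_le_sum_finrank [IsScalarTower K (MvPolynomial (Fin n) K) N]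
    [Module.Finite (MvPolynomial (Fin n) K) N]
    (h : IsGradedModule (n := n) 𝒩) {fs : List (MvPolynomial (Fin n) K)} (hfs : IsRegular N fs) :
    ∃ D, ∀ j, (j + 1) ^ fs.length ≤
      ∑ i ∈ Finset.range (D * (j + 1)), Module.finrank K (𝒩 i) := by
  obtain ⟨x, hx⟩ := RegularSequence.exists_forall_aeval_smul_eq_zero K fs hfs
  obtain ⟨E, hE⟩ := h.exists_mem_degreeLE x
  let D := ∑ i : Fin fs.length, fs[i].totalDegree
  -- The (j+1)^r products f^α x with all α_i ≤ j are independent and live in degrees at most Dj + E,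
  -- which is below (D+E+1)(j+1). Neither x nor the sequence need be homogeneous.
  refine ⟨D + E + 1, fun j => ?_⟩
  let L : MvPolynomial (Fin fs.length) K →ₗ[K] N :=
    (LinearMap.toSpanSingleton (MvPolynomial (Fin n) K) N x).restrictScalars K ∘ₗ
      (aeval (R := K) fun i : Fin fs.length => fs[i]).toLinearMap
  have hL : LinearMap.ker L = ⊥ := LinearMap.ker_eq_bot'.2 hx
  let ex : (Fin fs.length → Fin (j + 1)) → (Fin fs.length →₀ ℕ) := fun α =>
    Finsupp.equivFunOnFinite.symm fun i => (α i : ℕ)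
  have hex : Function.Injective ex := fun α β hαβ => by
    funext i
    exact Fin.ext (DFunLike.congr_fun hαβ i)
  have hli : LinearIndependent K fun α => L (monomial (ex α) 1) := by
    have := (basisMonomials (Fin fs.length) K).linearIndependent.comp ex hex
    rw [coe_basisMonomials] at this
    exact this.map' L hL
  have hmem : ∀ α, L (monomial (ex α) 1) ∈ degreeLE 𝒩 (D * j + E) := fun α => by
    change aeval (fun i : Fin fs.length => fs[i]) (monomial (ex α) (1 : K)) • x ∈ _
    refine h.smul_mem_degreeLE ?_ hE
    rw [aeval_monomial, map_one, one_mul, Finsupp.prod_fintype _ _ fun i => pow_zero _,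
      Finset.sum_mul]
    refine (totalDegree_finsetProd _ _).trans (Finset.sum_le_sum fun i _ => ?_)
    refine (totalDegree_pow _ _).trans ?_
    rw [mul_comm]
    exact Nat.mul_le_mul_left _ (Nat.lt_succ_iff.1 (α i).2)
  have : Module.Finite K (degreeLE 𝒩 (D * j + E)) := finite_degreeLE h.finite _
  have hcard := finrank_span_eq_card hli
  rw [Fintype.card_fun, Fintype.card_fin, Fintype.card_fin] at hcard
  rw [← hcard]
  refine (Submodule.finrank_mono (Submodule.span_le.2 (Set.range_subset_iff.2 hmem))).trans
    ((finrank_degreeLE_le h.finite _).trans ?_)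
  refine Finset.sum_le_sum_of_subset (Finset.range_subset_range.2 ?_)
  nlinarith [Nat.zero_le (E * j), Nat.zero_le D]

end Graded

end HilbertDepth

namespace HilbertDepth

open MvPolynomial RingTheory.Sequence

/-! ### Upper bound for the growth; depth and Hilbert depth. -/

section HilbertFunction

variable {K : Type u} [Field K] {n m : ℕ} {I : Ideal (MvPolynomial (Fin n) K)}
  {v : Fin m → (Fin n →₀ ℕ)}

/-- The exponents of the monomials of degree `j` outside the ideal generated by the monomials with
exponents `v i`. -/
def standardExponents (v : Fin m → (Fin n →₀ ℕ)) (j : ℕ) : Finset (Fin n → ℕ) :=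
  (Fintype.piFinset fun _ => Finset.range (j + 1)).filter fun a =>
    ∑ k, a k = j ∧ ∀ i, ∃ k, a k < v i k

theorem finrank_quotientGrading_le (h : IsMinimallyGeneratedBy I v) (j : ℕ) :
    Module.finrank K (quotientGrading I j) ≤ (standardExponents v j).card := by
  classical
  let g : (Fin n → ℕ) → MvPolynomial (Fin n) K ⧸ I := fun a =>
    Ideal.Quotient.mk I (monomial (Finsupp.equivFunOnFinite.symm a) 1)
  have hle : quotientGrading I j ≤ Submodule.span K ((standardExponents v j).image g : Set _) := by
    rw [quotientGrading_eq_monomialSpan, monomialSpan_eq_span, Submodule.span_le]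
    rintro _ ⟨a, ha, rfl⟩
    by_cases hE : ∃ i, v i ≤ a
    · have : Ideal.Quotient.mk I (monomial a 1) = 0 :=
        Ideal.Quotient.eq_zero_iff_mem.2 (h.monomial_mem_iff.2 hE)
      simp only [this]
      exact zero_mem _
    · refine Submodule.subset_span (Finset.mem_coe.2 (Finset.mem_image.2 ⟨a, ?_, ?_⟩))
      · have ha' : a.degree = j := ha
        rw [standardExponents, Finset.mem_filter, Fintype.mem_piFinset]
        refine ⟨fun k => Finset.mem_range.2 (Nat.lt_succ_of_le (ha' ▸ Finsupp.le_degree k a)),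
          by rw [← ha', Finsupp.degree_eq_sum], fun i => ?_⟩
        by_contra hcon
        push Not at hcon
        exact hE ⟨i, hcon⟩
      · exact congrArg (fun b => Ideal.Quotient.mk I (monomial b 1))
          (Finsupp.equivFunOnFinite.symm_apply_apply a)
  exact (Submodule.finrank_mono hle).trans
    ((finrank_span_finset_le_card _).trans Finset.card_image_le)

/-- The Hilbert function of the quotient by a monomial ideal with `m` coprime generators grows at
most like a polynomial of degree `n - m`. -/
theorem exists_sum_finrank_quotientGrading_le (h : IsMinimallyGeneratedBy I v)
    (hd : ∀ i j k, v i k ≠ 0 → v j k ≠ 0 → i = j) :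
    ∃ C, ∀ J, ∑ j ∈ Finset.range J, Module.finrank K (quotientGrading I j) ≤ C * J ^ (n - m) := by
  classical
  let V := ∑ i, ∑ k, v i k
  have hV : ∀ i k, v i k ≤ V := fun i k =>
    (Finset.single_le_sum (f := fun k => v i k) (fun _ _ => Nat.zero_le _)
      (Finset.mem_univ k)).trans
      (Finset.single_le_sum (f := fun i => ∑ k, v i k) (fun _ _ => Nat.zero_le _)
        (Finset.mem_univ i))
  -- Each τ picks one variable per generator. A standard monomial of degree below J lies in the box
  -- of some τ: exponents below V at the m picked variables and below J elsewhere.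
  let Θ : Finset (Fin m → Fin n) := Finset.univ.filter fun τ => ∀ i, v i (τ i) ≠ 0
  let box : ℕ → (Fin m → Fin n) → Finset (Fin n → ℕ) := fun J τ =>
    Fintype.piFinset fun k =>
      if k ∈ Finset.univ.image τ then Finset.range V else Finset.range J
  have hbox : ∀ J, ∀ τ ∈ Θ, (box J τ).card = V ^ m * J ^ (n - m) := by
    intro J τ hτ
    have hinj := injective_of_apply_ne_zero hd (Finset.mem_filter.1 hτ).2
    have hcard : (Finset.univ.image τ).card = m := by
      rw [Finset.card_image_of_injective _ hinj, Finset.card_univ, Fintype.card_fin]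
    rw [Fintype.card_piFinset, ← Finset.prod_mul_prod_compl (Finset.univ.image τ)]
    congr 1
    · rw [Finset.prod_congr rfl fun k hk => by rw [if_pos hk, Finset.card_range],
        Finset.prod_const, hcard]
    · rw [Finset.prod_congr rfl fun k hk => by
          rw [if_neg (Finset.mem_compl.1 hk), Finset.card_range],
        Finset.prod_const, Finset.card_compl, hcard, Fintype.card_fin]
  refine ⟨Θ.card * V ^ m, fun J => ?_⟩
  refine (Finset.sum_le_sum fun j _ => finrank_quotientGrading_le h j).trans ?_
  rw [← Finset.card_biUnion]
  · have hsub : (Finset.range J).biUnion (standardExponents v) ⊆ Θ.biUnion (box J) := by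
      intro a ha
      obtain ⟨j, hj, ha⟩ := Finset.mem_biUnion.1 ha
      rw [standardExponents, Finset.mem_filter, Fintype.mem_piFinset] at ha
      obtain ⟨ha1, -, ha2⟩ := ha
      choose τ hτ using ha2
      refine Finset.mem_biUnion.2 ⟨τ, Finset.mem_filter.2 ⟨Finset.mem_univ _, fun i => ?_⟩, ?_⟩
      · have := hτ i
        omega
      · refine Fintype.mem_piFinset.2 fun k => ?_
        split_ifs with hk
        · obtain ⟨i, -, rfl⟩ := Finset.mem_image.1 hk
          exact Finset.mem_range.2 ((hτ i).trans_le (hV _ _))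
        · have h1 := Finset.mem_range.1 (ha1 k)
          have h2 := Finset.mem_range.1 hj
          exact Finset.mem_range.2 (by omega)
    refine (Finset.card_le_card hsub).trans ?_
    rw [mul_assoc]
    exact Finset.card_biUnion_le_card_mul _ _ _ fun τ hτ => (hbox J τ hτ).le
  · intro i _ j _ hij
    refine Finset.disjoint_left.2 fun a hai haj => hij ?_
    rw [standardExponents, Finset.mem_filter] at hai haj
    exact hai.2.1.symm.trans haj.2.1

/-- The case j = C already excludes r > d. -/
theorem le_of_forall_pow_le_mul_pow {r d C : ℕ} (h : ∀ j, (j + 1) ^ r ≤ C * (j + 1) ^ d) :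
    r ≤ d := by
  by_contra! hlt
  have h1 : (C + 1) ^ (d + 1) ≤ C * (C + 1) ^ d :=
    (Nat.pow_le_pow_right (Nat.succ_pos C) hlt).trans (h C)
  rw [pow_succ, mul_comm] at h1
  have := Nat.le_of_mul_le_mul_right h1 (pow_pos (Nat.succ_pos C) d)
  omega

/-- The two growth bounds are compared. Since N enters the upper one only through its Hilbert
series, depth and Hilbert depth are bounded together. -/
theorem length_le_of_isRegular (h : IsMinimallyGeneratedBy I v)
    (hd : ∀ i j k, v i k ≠ 0 → v j k ≠ 0 → i = j) {N : Type u} [AddCommGroup N] [Module K N]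
    [Module (MvPolynomial (Fin n) K) N] [IsScalarTower K (MvPolynomial (Fin n) K) N]
    [Module.Finite (MvPolynomial (Fin n) K) N] {𝒩 : ℕ → Submodule K N}
    (hN : IsGradedModule (n := n) 𝒩) (hilb : hilbertSeries 𝒩 = hilbertSeries (quotientGrading I))
    {fs : List (MvPolynomial (Fin n) K)} (hfs : IsRegular N fs) : fs.length ≤ n - m := by
  have hfin : ∀ j, Module.finrank K (𝒩 j) = Module.finrank K (quotientGrading I j) := fun j => by
    have := congrArg (PowerSeries.coeff j) hilb
    rw [hilbertSeries, hilbertSeries, PowerSeries.coeff_mk, PowerSeries.coeff_mk] at this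
    exact_mod_cast this
  obtain ⟨D, hD⟩ := hN.exists_pow_le_sum_finrank hfs
  obtain ⟨C, hC⟩ := exists_sum_finrank_quotientGrading_le h hd
  refine le_of_forall_pow_le_mul_pow (C := C * D ^ (n - m)) fun j => (hD j).trans ?_
  rw [Finset.sum_congr rfl fun i _ => hfin i, mul_assoc, ← mul_pow]
  exact hC _

theorem isDepth_quotient (h : IsMinimallyGeneratedBy I v) (hv : ∀ i, v i ≠ 0)
    (hd : ∀ i j k, v i k ≠ 0 → v j k ≠ 0 → i = j) :
    IsDepth K n (MvPolynomial (Fin n) K ⧸ I) (n - m) := by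
  refine ⟨exists_isRegular_quotient h hv hd, ?_⟩
  rintro r ⟨fs, rfl, -, hfs⟩
  exact length_le_of_isRegular h hd (isGradedModule_quotientGrading h) rfl hfs

theorem isHilbertDepth_quotient (h : IsMinimallyGeneratedBy I v) (hv : ∀ i, v i ≠ 0)
    (hd : ∀ i j k, v i k ≠ 0 → v j k ≠ 0 → i = j) :
    IsHilbertDepth n (quotientGrading I) (n - m) := by
  refine ⟨⟨MvPolynomial (Fin n) K ⧸ I, inferInstance, inferInstance, inferInstance, inferInstance,
    quotientGrading I, inferInstance, isGradedModule_quotientGrading h, rfl,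
    isDepth_quotient h hv hd⟩, ?_⟩
  rintro r ⟨N, _, _, _, _, 𝒩, _, hN, hilb, ⟨⟨fs, rfl, -, hfs⟩, -⟩⟩
  exact length_le_of_isRegular h hd hN hilb hfs

end HilbertFunction

end HilbertDepth

theorem mainTheorem3 {K : Type u} [Field K] [Infinite K] {n m : ℕ}
    (I : Ideal (MvPolynomial (Fin n) K)) (v : Fin m → (Fin n →₀ ℕ))
    (hmin : HilbertDepth.IsMinimallyGeneratedBy I v)
    (hci : HilbertDepth.IsCompleteIntersection I) :
    m ≤ n ∧
      HilbertDepth.IsHilbertDepth n (HilbertDepth.quotientGrading I) (n - m) ∧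
      ringKrullDim (MvPolynomial (Fin n) K ⧸ I) = ((n - m : ℕ) : WithBot ℕ∞) ∧
      HilbertDepth.IsStanleyDepth I (n - m) ∧
      HilbertDepth.IsDepth K n (MvPolynomial (Fin n) K ⧸ I) (n - m) := by
  have hv := hmin.ne_zero hci.ne_top
  have hd : ∀ i j k, v i k ≠ 0 → v j k ≠ 0 → i = j := fun _ _ _ =>
    HilbertDepth.IsCompleteIntersection.eq_of_mem_support hmin hci
  exact ⟨HilbertDepth.le_of_apply_ne_zero hv hd, HilbertDepth.isHilbertDepth_quotient hmin hv hd,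
    HilbertDepth.ringKrullDim_quotient_eq hmin hci hv hd, HilbertDepth.isStanleyDepth hmin hv hd,
    HilbertDepth.isDepth_quotient hmin hv hd⟩
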